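/- Let $\Psi\in C_0^\infty(\mathbb{R})$ be real-valued with $\operatorname{supp}\Psi=[-1,1]$, and let $L^2_{|\Psi|}(-1,1)$ be the complex Hilbert space of (classes of) functions on $(-1,1)$ that are square integrable with respect to the measure $|\Psi|\,d\xi$. Let $\mathcal{T}_\Psi=\frac{1}{\Psi}\frac{d^4}{d\xi^4}$ be the operator in $L^2_{|\Psi|}(-1,1)$ with domain $$\mathcal{D}(\mathcal{T}_\Psi)=\{f\in L^2_{|\Psi|}(-1,1)\colon \Psi^{-1}f^{(4)}\in L^2_{|\Psi|}(-1,1),\ f''(\pm1)=f'''(\pm1)=0\};$$ here $\mathcal{T}_\Psi f=g$ means that $f$ has a representative in the Sobolev space $W_2^4(-1,1)$ that satisfies $f^{(4)}=\Psi g$ almost everywhere on $(-1,1)$ and the boundary conditions. Then the following hold. 1. The spectrum $\sigma(\mathcal{T}_\Psi)$ is real and discrete: $\sigma(\mathcal{T}_\Psi)\subset\mathbb{R}$, it has no finite accumulation point, and each of its points is an eigenvalue of finite algebraic multiplicity. 2. If $\Psi$ changes sign (that is, takes both positive and negative values), then the accumulation points of $\sigma(\mathcal{T}_\Psi)$ in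 $[-\infty,+\infty]$ are exactly $-\infty$ and $+\infty$. 3. With the resonant set defined by $\Sigma_\Psi=\{\alpha\in\mathbb{R}\colon -\alpha\in\sigma(\mathcal{T}_\Psi)\}$, one has $\sigma(\mathcal{T}_\Psi)=\{-\alpha\colon\alpha\in\Sigma_\Psi\}$, and $\Sigma_\Psi$ is the set of all real $\alpha$ for which the problem $w^{(4)}+\alpha\Psi w=0$ on $(-1,1)$, $w''(\pm1)=w'''(\pm1)=0$, has a nontrivial solution. -/

import Mathlib

open Set Filter Topology MeasureTheory
open scoped ContDiff ENNReal

/-! ### Spectral notions for unbounded operators -/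

section Spectral

/-- The resolvent set of an unbounded operator `T` in `H`: those `z` for which `T - z` maps its
domain bijectively onto `H` with bounded inverse `R`. -/
def unboundedResolventSet {H : Type*} [NormedAddCommGroup H] [NormedSpace ℂ H]
    (T : H →ₗ.[ℂ] H) : Set ℂ :=
  {z | ∃ R : H →L[ℂ] H,
    (∀ f : H, ∃ hf : R f ∈ T.domain, T ⟨R f, hf⟩ - z • R f = f) ∧
    (∀ u : T.domain, R (T u - z • (u : H)) = u)}

/-- The spectrum of an unbounded operator: the complement of its resolvent set. -/
def unboundedSpectrum {H : Type*} [NormedAddCommGroup H] [NormedSpace ℂ H]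
    (T : H →ₗ.[ℂ] H) : Set ℂ :=
  (unboundedResolventSet T)ᶜ

/-- `z` is an eigenvalue of `T`. -/
def IsUnboundedEigenvalue {H : Type*} [NormedAddCommGroup H] [NormedSpace ℂ H]
    (T : H →ₗ.[ℂ] H) (z : ℂ) : Prop :=
  ∃ u : T.domain, (u : H) ≠ 0 ∧ T u = z • (u : H)

/-- `iteratedKer T z n` is the kernel of `(T - z) ^ n`, on its natural domain: it consists of the
`u` in the domain of `T` with `(T - z) u` in the kernel of `(T - z) ^ (n - 1)`. -/
def iteratedKer {H : Type*} [NormedAddCommGroup H] [NormedSpace ℂ H]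
    (T : H →ₗ.[ℂ] H) (z : ℂ) : ℕ → Submodule ℂ H
  | 0 => ⊥
  | n + 1 => ((iteratedKer T z n).comap (T.toFun - z • T.domain.subtype)).map T.domain.subtype

/-- The root subspace of `T` at `z`, whose dimension is the algebraic multiplicity of `z`. -/
def rootSubspace {H : Type*} [NormedAddCommGroup H] [NormedSpace ℂ H]
    (T : H →ₗ.[ℂ] H) (z : ℂ) : Submodule ℂ H :=
  ⨆ n : ℕ, iteratedKer T z n

/-- The spectrum of `T` is discrete: it has no finite accumulation point, and each of its points is
an eigenvalue of finite algebraic multiplicity. -/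
structure HasDiscreteSpectrum {H : Type*} [NormedAddCommGroup H] [NormedSpace ℂ H]
    (T : H →ₗ.[ℂ] H) : Prop where
  not_accPt : ∀ z : ℂ, ¬ AccPt z (𝓟 (unboundedSpectrum T))
  eigenvalue : ∀ z ∈ unboundedSpectrum T, IsUnboundedEigenvalue T z
  finite_mult : ∀ z ∈ unboundedSpectrum T, FiniteDimensional ℂ (rootSubspace T z)

/-- The accumulation points, in the extended real line `[-∞, ∞]`, of the set of real points of the
spectrum of `T`. -/
def extendedAccumulationPoints {H : Type*} [NormedAddCommGroup H] [NormedSpace ℂ H]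
    (T : H →ₗ.[ℂ] H) : Set EReal :=
  {x | AccPt x (𝓟 ((fun t : ℝ => (t : EReal)) '' {t : ℝ | (t : ℂ) ∈ unboundedSpectrum T}))}

end Spectral

/-! ### The weighted space, the Sobolev space and the boundary conditions -/

/-- A real-valued smooth function on the line with support `[-1, 1]`. -/
structure Shape where
  toFun : ℝ → ℝ
  smooth : ContDiff ℝ ∞ toFun
  tsupport_eq : tsupport toFun = Icc (-1) 1

instance : CoeFun Shape (fun _ => ℝ → ℝ) := ⟨Shape.toFun⟩

/-- `Ψ` takes both positive and negative values. -/
def Shape.ChangesSign (Ψ : Shape) : Prop :=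
  (∃ x, 0 < Ψ x) ∧ (∃ x, Ψ x < 0)

/-- The measure `|Ψ| dξ` on `(-1, 1)`. -/
noncomputable def Shape.weight (Ψ : Shape) : Measure ℝ :=
  (volume.restrict (Ioo (-1) 1)).withDensity (fun ξ => ENNReal.ofReal |Ψ ξ|)

/-- The complex Hilbert space `L²_{|Ψ|}(-1, 1)`. -/
abbrev Shape.Space (Ψ : Shape) : Type := Lp ℂ 2 Ψ.weight

/-- `u` belongs to the Sobolev space `W₂⁴(-1, 1)` and `v ∈ L²(-1, 1)` is its fourth (weak)
derivative, `u` being the representative of its class that is `C³` on `[-1, 1]`: the third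
derivative is absolutely continuous, with density `v`. -/
structure IsW42 (u v : ℝ → ℂ) : Prop where
  contDiffOn : ContDiffOn ℝ 3 u (Icc (-1) 1)
  memLp : MemLp v 2 (volume.restrict (Ioo (-1) 1))
  eq_integral : ∀ x ∈ Icc (-1 : ℝ) 1,
    iteratedDerivWithin 3 u (Icc (-1) 1) x =
      iteratedDerivWithin 3 u (Icc (-1) 1) (-1) + ∫ ξ in (-1 : ℝ)..x, v ξ

/-- The boundary conditions `u''(±1) = u'''(±1) = 0` (one-sided derivatives). -/
def NeumannBC (u : ℝ → ℂ) : Prop :=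
  iteratedDerivWithin 2 u (Icc (-1) 1) (-1) = 0 ∧ iteratedDerivWithin 2 u (Icc (-1) 1) 1 = 0 ∧
  iteratedDerivWithin 3 u (Icc (-1) 1) (-1) = 0 ∧ iteratedDerivWithin 3 u (Icc (-1) 1) 1 = 0

/-- The relation between classes `f, g ∈ L²_{|Ψ|}(-1, 1)` that says `f ∈ W₂⁴(-1, 1)`,
`f⁗ = Ψ g` almost everywhere on `(-1, 1)`, and `f''(±1) = f'''(±1) = 0`. -/
def Shape.Rel (Ψ : Shape) (f g : Ψ.Space) : Prop :=
  ∃ u v : ℝ → ℂ, IsW42 u v ∧ NeumannBC u ∧ f =ᵐ[Ψ.weight] u ∧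
    ∀ᵐ ξ ∂(volume.restrict (Ioo (-1 : ℝ) 1)), v ξ = (Ψ ξ : ℂ) * g ξ

theorem IsW42.intervalIntegrable {u v : ℝ → ℂ} (h : IsW42 u v) :
    IntervalIntegrable v volume (-1) 1 := by
  rw [intervalIntegrable_iff_integrableOn_Ioo_of_le (by norm_num)]
  exact h.memLp.integrable (by norm_num)

theorem IsW42.intervalIntegrable' {u v : ℝ → ℂ} (h : IsW42 u v) {x : ℝ}
    (hx : x ∈ Icc (-1 : ℝ) 1) : IntervalIntegrable v volume (-1) x := by
  refine h.intervalIntegrable.mono_set ?_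
  rw [uIcc_of_le hx.1, uIcc_of_le (by norm_num)]
  exact Icc_subset_Icc le_rfl hx.2

theorem uniqueDiffOn_Icc_neg_one_one : UniqueDiffOn ℝ (Icc (-1 : ℝ) 1) :=
  uniqueDiffOn_Icc (by norm_num)

theorem IsW42.iteratedDerivWithin_add {u₁ v₁ u₂ v₂ : ℝ → ℂ} (h₁ : IsW42 u₁ v₁) (h₂ : IsW42 u₂ v₂)
    {n : ℕ} (hn : n ≤ 3) {x : ℝ} (hx : x ∈ Icc (-1 : ℝ) 1) :
    iteratedDerivWithin n (u₁ + u₂) (Icc (-1) 1) x =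
      iteratedDerivWithin n u₁ (Icc (-1) 1) x + iteratedDerivWithin n u₂ (Icc (-1) 1) x :=
  _root_.iteratedDerivWithin_add hx uniqueDiffOn_Icc_neg_one_one
    ((h₁.contDiffOn x hx).of_le (by exact_mod_cast hn))
    ((h₂.contDiffOn x hx).of_le (by exact_mod_cast hn))

theorem IsW42.add {u₁ v₁ u₂ v₂ : ℝ → ℂ} (h₁ : IsW42 u₁ v₁) (h₂ : IsW42 u₂ v₂) :
    IsW42 (u₁ + u₂) (v₁ + v₂) where
  contDiffOn := h₁.contDiffOn.add h₂.contDiffOn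
  memLp := h₁.memLp.add h₂.memLp
  eq_integral x hx := by
    have hm : (-1 : ℝ) ∈ Icc (-1 : ℝ) 1 := by simp
    rw [h₁.iteratedDerivWithin_add h₂ le_rfl hx, h₁.iteratedDerivWithin_add h₂ le_rfl hm,
      h₁.eq_integral x hx, h₂.eq_integral x hx]
    simp only [Pi.add_apply]
    rw [intervalIntegral.integral_add (h₁.intervalIntegrable' hx) (h₂.intervalIntegrable' hx)]
    ring

theorem IsW42.const_smul {u v : ℝ → ℂ} (h : IsW42 u v) (c : ℂ) : IsW42 (c • u) (c • v) where
  contDiffOn := h.contDiffOn.const_smul c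
  memLp := h.memLp.const_smul c
  eq_integral x hx := by
    rw [iteratedDerivWithin_const_smul_field, iteratedDerivWithin_const_smul_field,
      h.eq_integral x hx]
    simp only [Pi.smul_apply]
    rw [intervalIntegral.integral_smul, smul_add]

theorem Shape.ae_of_ae_weight (Ψ : Shape) {p : ℝ → Prop} (h : ∀ᵐ ξ ∂Ψ.weight, p ξ) :
    ∀ᵐ ξ ∂(volume.restrict (Ioo (-1 : ℝ) 1)), Ψ ξ ≠ 0 → p ξ := by
  have hm : Measurable (fun ξ => ENNReal.ofReal |Ψ ξ|) :=
    (Ψ.smooth.continuous.abs.measurable).ennreal_ofReal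
  rw [Shape.weight, ae_withDensity_iff hm] at h
  filter_upwards [h] with ξ hξ hne
  exact hξ (by simpa using hne)

theorem Shape.ae_weight_of_ae (Ψ : Shape) {p : ℝ → Prop}
    (h : ∀ᵐ ξ ∂(volume.restrict (Ioo (-1 : ℝ) 1)), Ψ ξ ≠ 0 → p ξ) : ∀ᵐ ξ ∂Ψ.weight, p ξ := by
  have hm : Measurable (fun ξ => ENNReal.ofReal |Ψ ξ|) :=
    (Ψ.smooth.continuous.abs.measurable).ennreal_ofReal
  rw [Shape.weight, ae_withDensity_iff hm]
  filter_upwards [h] with ξ hξ hne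
  exact hξ (by simpa using hne)

/-- The graph of the operator `Ψ⁻¹ d⁴/dξ⁴`, a linear subspace. -/
def Shape.graph (Ψ : Shape) : Submodule ℂ (Ψ.Space × Ψ.Space) where
  carrier := {p | Ψ.Rel p.1 p.2}
  zero_mem' := by
    refine ⟨0, 0, ⟨contDiffOn_const, MemLp.zero', ?_⟩, ?_, Lp.coeFn_zero _ _ _, ?_⟩
    · intro x _
      simp [Pi.zero_def]
    · simp [NeumannBC, Pi.zero_def]
    · filter_upwards [Ψ.ae_of_ae_weight (Lp.coeFn_zero ℂ 2 Ψ.weight)] with ξ hξ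
      by_cases h : Ψ ξ = 0
      · simp [h]
      · simpa [h] using hξ h
  add_mem' := by
    rintro ⟨f₁, g₁⟩ ⟨f₂, g₂⟩ ⟨u₁, v₁, hw₁, hb₁, hf₁, hg₁⟩ ⟨u₂, v₂, hw₂, hb₂, hf₂, hg₂⟩
    refine ⟨u₁ + u₂, v₁ + v₂, hw₁.add hw₂, ?_, ?_, ?_⟩
    · obtain ⟨a₁, b₁, c₁, d₁⟩ := hb₁
      obtain ⟨a₂, b₂, c₂, d₂⟩ := hb₂
      have hm : (-1 : ℝ) ∈ Icc (-1 : ℝ) 1 := by simp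
      have hp : (1 : ℝ) ∈ Icc (-1 : ℝ) 1 := by simp
      refine ⟨?_, ?_, ?_, ?_⟩
      · rw [hw₁.iteratedDerivWithin_add hw₂ (by norm_num) hm, a₁, a₂, add_zero]
      · rw [hw₁.iteratedDerivWithin_add hw₂ (by norm_num) hp, b₁, b₂, add_zero]
      · rw [hw₁.iteratedDerivWithin_add hw₂ (by norm_num) hm, c₁, c₂, add_zero]
      · rw [hw₁.iteratedDerivWithin_add hw₂ (by norm_num) hp, d₁, d₂, add_zero]
    · exact (Lp.coeFn_add f₁ f₂).trans (hf₁.add hf₂)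
    · filter_upwards [hg₁, hg₂, Ψ.ae_of_ae_weight (Lp.coeFn_add g₁ g₂)] with ξ h₁ h₂ h
      by_cases h0 : Ψ ξ = 0
      · simp [h₁, h₂, h0]
      · have := h h0
        simp only [Pi.add_apply] at this
        simp only [Prod.mk_add_mk, Pi.add_apply, h₁, h₂, this, mul_add]
  smul_mem' := by
    rintro c ⟨f, g⟩ ⟨u, v, hw, ⟨a, b, c', d⟩, hf, hg⟩
    refine ⟨c • u, c • v, hw.const_smul c, ?_, ?_, ?_⟩
    · refine ⟨?_, ?_, ?_, ?_⟩ <;> rw [iteratedDerivWithin_const_smul_field] <;> simp [a, b, c', d]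
    · exact (Lp.coeFn_smul c f).trans (hf.const_smul c)
    · filter_upwards [hg, Ψ.ae_of_ae_weight (Lp.coeFn_smul c g)] with ξ h₁ h
      by_cases h0 : Ψ ξ = 0
      · simp [h₁, h0]
      · have := h h0
        simp only [Pi.smul_apply, smul_eq_mul] at this
        simp only [Prod.smul_mk, Pi.smul_apply, h₁, this, smul_eq_mul]
        ring

/-- The operator `T_Ψ = Ψ⁻¹ d⁴/dξ⁴` in `L²_{|Ψ|}(-1, 1)` with the boundary conditions
`f''(±1) = f'''(±1) = 0`. -/
noncomputable def Shape.operator (Ψ : Shape) : Ψ.Space →ₗ.[ℂ] Ψ.Space :=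
  Ψ.graph.toLinearPMap

theorem Shape.graph_single_valued (Ψ : Shape) (p : Ψ.Space × Ψ.Space) (hp : p ∈ Ψ.graph)
    (h0 : p.1 = 0) : p.2 = 0 := by
  obtain ⟨f, g⟩ := p
  obtain ⟨u, v, hw, -, hf, hg⟩ := hp
  simp only at h0 hf hg ⊢
  subst h0
  -- The set where `Ψ` does not vanish is open and dense in `[-1, 1]`.
  have hopen : IsOpen (Function.support Ψ) := Ψ.smooth.continuous.isOpen_support
  have hcl : closure (Function.support Ψ) = Icc (-1 : ℝ) 1 := Ψ.tsupport_eq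
  have hsub : Function.support Ψ ⊆ Icc (-1 : ℝ) 1 := hcl ▸ subset_closure
  have hsub' : Function.support Ψ ⊆ Ioo (-1 : ℝ) 1 := by
    rw [← interior_Icc]
    exact interior_maximal hsub hopen
  have h1 : u =ᵐ[volume.restrict (Function.support Ψ)] (fun _ => 0) := by
    have h2 : ∀ᵐ ξ ∂Ψ.weight, u ξ = 0 := by
      filter_upwards [hf, Lp.coeFn_zero ℂ 2 Ψ.weight] with ξ h₁ h₂
      rw [← h₁, h₂, Pi.zero_apply]
    have h3 := ae_mono (Measure.restrict_mono hsub' le_rfl) (Ψ.ae_of_ae_weight h2)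
    filter_upwards [h3, ae_restrict_mem hopen.measurableSet] with ξ h₁ h₂
    exact h₁ h₂
  have h2 : EqOn u (fun _ => 0) (Function.support Ψ) :=
    Measure.eqOn_open_of_ae_eq h1 hopen (hw.contDiffOn.continuousOn.mono hsub) continuousOn_const
  have h3 : EqOn u (fun _ => 0) (Icc (-1) 1) :=
    h2.of_subset_closure hw.contDiffOn.continuousOn continuousOn_const hsub hcl.symm.subset
  have h4 : ∀ x ∈ Icc (-1 : ℝ) 1, iteratedDerivWithin 3 u (Icc (-1) 1) x = 0 := by
    intro x hx
    rw [iteratedDerivWithin_congr h3 hx, iteratedDerivWithin_const]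
    simp
  have h5 : ∀ x ∈ Icc (-1 : ℝ) 1, ∫ ξ in (-1 : ℝ)..x, v ξ = 0 := by
    intro x hx
    have := hw.eq_integral x hx
    rw [h4 x hx, h4 (-1) (by simp), zero_add] at this
    exact this.symm
  have h6 : ∀ᵐ x ∂(volume.restrict (Ioo (-1 : ℝ) 1)), v x = 0 := by
    rw [ae_restrict_iff' measurableSet_Ioo]
    filter_upwards [hw.intervalIntegrable.ae_hasDerivAt_integral] with x hx hxI
    have hx' : x ∈ uIcc (-1 : ℝ) 1 := by
      rw [uIcc_of_le (by norm_num)]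
      exact Ioo_subset_Icc_self hxI
    have hd := hx hx' (-1) (by simp)
    have he : (fun y => ∫ ξ in (-1 : ℝ)..y, v ξ) =ᶠ[𝓝 x] fun _ => (0 : ℂ) := by
      filter_upwards [Ioo_mem_nhds hxI.1 hxI.2] with y hy
      exact h5 y (Ioo_subset_Icc_self hy)
    exact (hd.congr_of_eventuallyEq he.symm).unique (hasDerivAt_const x (0 : ℂ))
  rw [Lp.eq_zero_iff_ae_eq_zero]
  refine Ψ.ae_weight_of_ae ?_
  filter_upwards [h6, hg] with ξ h₁ h₂ hne
  rw [h₁] at h₂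
  have hne' : (Ψ ξ : ℂ) ≠ 0 := by exact_mod_cast hne
  simpa [hne'] using h₂.symm

/-- The operator has exactly the prescribed graph: `T_Ψ f = g` means that `f ∈ W₂⁴(-1, 1)`,
`f⁗ = Ψ g`, and `f''(±1) = f'''(±1) = 0`. -/
theorem Shape.mem_graph_operator (Ψ : Shape) (f g : Ψ.Space) :
    (f, g) ∈ Ψ.operator.graph ↔ Ψ.Rel f g := by
  rw [Shape.operator, Submodule.toLinearPMap_graph_eq _ Ψ.graph_single_valued]
  rfl

/-! ### The resonant set -/

/-- The resonant set `Σ_Ψ = {α ∈ ℝ : -α ∈ σ(T_Ψ)}`. -/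
def Shape.resonantSet (Ψ : Shape) : Set ℝ :=
  {α | ((-α : ℝ) : ℂ) ∈ unboundedSpectrum Ψ.operator}

/-- `w` is a nontrivial classical solution of `w⁗ + α Ψ w = 0` on `(-1, 1)`,
`w''(±1) = w'''(±1) = 0`. -/
structure Shape.IsResonance (Ψ : Shape) (α : ℝ) (w : ℝ → ℂ) : Prop where
  contDiffOn : ContDiffOn ℝ 4 w (Icc (-1) 1)
  equation : ∀ ξ ∈ Ioo (-1 : ℝ) 1,
    iteratedDerivWithin 4 w (Icc (-1) 1) ξ + (α : ℂ) * (Ψ ξ : ℂ) * w ξ = 0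
  boundary : NeumannBC w
  nontrivial : ∃ ξ ∈ Ioo (-1 : ℝ) 1, w ξ ≠ 0

/-! ### Compact self-adjoint operators -/

section Abstract

open Module.End ContinuousLinearMap

variable {X : Type*} [NormedAddCommGroup X] [InnerProductSpace ℂ X] [CompleteSpace X]

/-! On `L²(-1,1)` let `V` be integration from `-1`, `P` the orthogonal projection onto the affine
functions, `K = V²(1 - P)`, and `M` multiplication by `Ψ`. The problem `U⁗ = F` with the boundary
conditions is solvable iff `PF = 0`, and then `U - PU = K†K F`: the conditions at `1` say that `F`
is orthogonal to the affine functions, on whose complement `V†² = V²` (`rel_iff`,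
`lift_iff_pencil`). Hence `T_Ψ - z` is governed by `1 - A(z)`, where `A(z) = P + z(P + K†K)M` is
compact, and by the Fredholm alternative the spectrum consists of the `z` for which `A(z)` has a
nonzero fixed vector; all of these are eigenvalues.

Since `Ψ` may be indefinite, reality does not come from symmetry in the weighted space. For `z ≠ 0`
the fixed vectors satisfy `PMu = 0`, `u - Pu = zK†KMu`. Eliminating the affine component by a
generalized inverse of `PMP` turns this into `Dq = z⁻¹q` for `q = KMu`, with `D` compact and
self-adjoint (`exists_compact_linearization`). So the eigenvalues are real and locally finite. Root
subspaces are finite-dimensional because eigenspaces are, and because the energy identity `⟨Ψg, U⟩ =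
‖KΨg‖²` for `U⁗ = Ψg` stops Jordan chains.

The form of `D` is that of `M` on the constrained vectors. Where `Ψ > 0`, bump functions times
polynomials form an infinite-dimensional space on which `M` is positive, so `D` cannot have only
finitely many positive eigenvalues; `-Ψ` gives the negative ones. Resonances are eigenfunctions:
continuity of `Ψu` makes an eigenfunction `C⁴`. -/

theorem inner_apply_of_isSelfAdjoint {A : X →L[ℂ] X} (hA : IsSelfAdjoint A) (x y : X) :
    inner ℂ (A x) y = inner ℂ x (A y) :=
  (isSelfAdjoint_iff_isSymmetric.mp hA) x y

/-- A self-adjoint operator of finite rank has a self-adjoint generalized inverse. -/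
theorem exists_pseudoinverse {G : X →L[ℂ] X} (hG : IsSelfAdjoint G)
    [FiniteDimensional ℂ G.range] :
    ∃ B E : X →L[ℂ] X, IsSelfAdjoint B ∧ IsSelfAdjoint E ∧
      (∀ x, G (B x) = E x) ∧ (∀ x, B (G x) = E x) ∧ (∀ x, E (G x) = G x) ∧
      (∀ x, G (E x) = G x) ∧ (∀ x, E (B x) = B x) := by
  let R := G.range
  let g : R →ₗ[ℂ] R := G.toLinearMap.restrict (p := R) (q := R) (fun x _ => ⟨x, rfl⟩)
  have hg : ∀ x : R, (g x : X) = G x := fun x => rfl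
  -- The kernel of a self-adjoint operator is orthogonal to its range, so `G` is injective on its
  -- finite-dimensional range, hence bijective there.
  have hinj : Function.Injective g := by
    rw [injective_iff_map_eq_zero]
    rintro ⟨_, x, rfl⟩ hx
    have h1 : G (G x) = 0 := by
      have := congrArg Subtype.val hx
      simpa [hg] using this
    have h2 : inner ℂ (G x) (G x) = 0 := by
      rw [inner_apply_of_isSelfAdjoint hG, h1, inner_zero_right]
    exact Subtype.ext (inner_self_eq_zero.mp h2)
  let e := LinearEquiv.ofInjectiveEndo g hinj
  let B : X →L[ℂ] X :=
    R.subtypeL ∘L (LinearMap.toContinuousLinearMap e.symm.toLinearMap) ∘L R.orthogonalProjectionOnto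
  let E : X →L[ℂ] X := R.starProjection
  have hE : IsSelfAdjoint E := isSelfAdjoint_starProjection R
  have hBx : ∀ x, B x = (e.symm (R.orthogonalProjectionOnto x) : X) := fun x => rfl
  have h1 : ∀ x, G (B x) = E x := by
    intro x
    have : (e (e.symm (R.orthogonalProjectionOnto x)) : X) = G (B x) := rfl
    rw [← this, e.apply_symm_apply]; rfl
  have h3 : ∀ x, E (G x) = G x := fun x => Submodule.starProjection_eq_self_iff.mpr ⟨x, rfl⟩
  have h4 : ∀ x, G (E x) = G x := by
    intro x
    refine ext_inner_right ℂ fun y => ?_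
    rw [inner_apply_of_isSelfAdjoint hG, inner_apply_of_isSelfAdjoint hE, h3,
      inner_apply_of_isSelfAdjoint hG]
  have h5 : ∀ x, E (B x) = B x := fun x =>
    Submodule.starProjection_eq_self_iff.mpr (Subtype.coe_prop _)
  have hB : IsSelfAdjoint B := by
    rw [isSelfAdjoint_iff_isSymmetric]
    intro x y
    simp only [ContinuousLinearMap.coe_coe]
    rw [← h5 x, inner_apply_of_isSelfAdjoint hE, ← h1 y, ← inner_apply_of_isSelfAdjoint hG, h1,
      inner_apply_of_isSelfAdjoint hE, h5]
  refine ⟨B, E, hB, hE, h1, fun x => ?_, h3, h4, h5⟩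
  refine ext_inner_right ℂ fun y => ?_
  rw [inner_apply_of_isSelfAdjoint hB, inner_apply_of_isSelfAdjoint hG, h1,
    inner_apply_of_isSelfAdjoint hE]

/-- The eigenvalues of a compact self-adjoint operator accumulate only at zero. -/
theorem finite_eigenvalues_of_le_norm {D : X →L[ℂ] X} (hc : IsCompactOperator D)
    (hs : IsSelfAdjoint D) {ε : ℝ} (hε : 0 < ε) :
    {μ : ℂ | HasEigenvalue (D : Module.End ℂ X) μ ∧ ε ≤ ‖μ‖}.Finite := by
  by_contra hinf
  let f := Set.Infinite.natEmbedding _ hinf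
  have hex : ∀ n, ∃ v : X, ‖v‖ = 1 ∧ D v = (f n : ℂ) • v := by
    intro n
    obtain ⟨v, hv⟩ := (f n).2.1.exists_hasEigenvector
    have hv0 : ‖v‖ ≠ 0 := norm_ne_zero_iff.mpr hv.2
    refine ⟨((‖v‖⁻¹ : ℝ) : ℂ) • v, ?_, ?_⟩
    · rw [norm_smul]; simp [hv0]
    · have : D v = (f n : ℂ) • v := hv.apply_eq_smul
      rw [map_smul, this, smul_comm]
  choose v hv1 hv2 using hex
  have horth : ∀ m n, m ≠ n → inner ℂ (v m) (v n) = 0 := by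
    intro m n hmn
    have hne : (f m : ℂ) ≠ f n := fun h => hmn (f.injective (Subtype.ext h))
    have := (isSelfAdjoint_iff_isSymmetric.mp hs).orthogonalFamily_eigenspaces hne
      ⟨v m, mem_eigenspace_iff.mpr (hv2 m)⟩ ⟨v n, mem_eigenspace_iff.mpr (hv2 n)⟩
    simpa using this
  -- The images of the orthonormal eigenvectors are pairwise orthogonal of norm at least `ε`, so
  -- they have no Cauchy subsequence.
  obtain ⟨C, hC, hsub⟩ := hc.image_closedBall_subset_compact (𝕜₁ := ℂ) (f := D.toLinearMap) 1
  obtain ⟨y, -, φ, hφ, hlim⟩ := hC.tendsto_subseq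
    (x := fun n => D (v n)) (fun n => hsub ⟨v n, by simp [hv1], rfl⟩)
  have hcau := hlim.cauchySeq
  rw [Metric.cauchySeq_iff'] at hcau
  obtain ⟨n, hn⟩ := hcau ε hε
  have hlt := hn (n + 1) (Nat.le_succ n)
  have hne : φ (n + 1) ≠ φ n := fun h => by simpa using hφ.injective h
  rw [dist_eq_norm] at hlt
  simp only [Function.comp_apply, hv2] at hlt
  have hsq : ‖(f (φ (n + 1)) : ℂ) • v (φ (n + 1)) - (f (φ n) : ℂ) • v (φ n)‖ ^ 2 =
      ‖(f (φ (n + 1)) : ℂ)‖ ^ 2 + ‖(f (φ n) : ℂ)‖ ^ 2 := by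
    have := norm_sub_sq (𝕜 := ℂ) ((f (φ (n + 1)) : ℂ) • v (φ (n + 1))) ((f (φ n) : ℂ) • v (φ n))
    rw [this, inner_smul_left, inner_smul_right, horth _ _ hne]
    simp [norm_smul, hv1]
  have h1 : ε ≤ ‖(f (φ (n + 1)) : ℂ)‖ := (f (φ (n + 1))).2.2
  have h2 := sq_nonneg ‖(f (φ n) : ℂ)‖
  have h3 : ‖(f (φ (n + 1)) : ℂ) • v (φ (n + 1)) - (f (φ n) : ℂ) • v (φ n)‖ ^ 2 < ε ^ 2 :=
    pow_lt_pow_left₀ hlt (norm_nonneg _) two_ne_zero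
  nlinarith [pow_le_pow_left₀ hε.le h1 2]

/-- A compact self-adjoint operator without positive eigenvalues is nonpositive. -/
theorem re_inner_nonpos_of_forall_hasEigenvalue {S : X →L[ℂ] X} (hc : IsCompactOperator S)
    (hs : IsSelfAdjoint S)
    (h : ∀ t : ℝ, 0 < t → ¬ HasEigenvalue (S : Module.End ℂ X) (t : ℂ)) (x : X) :
    (inner ℂ (S x) x).re ≤ 0 := by
  have hnonneg : 0 ≤ -S := by
    rw [StarOrderedRing.nonneg_iff_spectrum_nonneg (R := ℝ) (-S) hs.neg]
    intro t ht
    by_contra hneg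
    push Not at hneg
    have h1 : ((-t : ℝ) : ℂ) ∈ spectrum ℂ S := by
      have h2 : (t : ℂ) ∈ spectrum ℂ (-S) := by
        have := spectrum.algebraMap_mem ℂ ht
        simpa using this
      rw [← spectrum.neg_eq] at h2
      simpa using h2
    have hne : ((-t : ℝ) : ℂ) ≠ 0 := by
      exact_mod_cast (neg_pos.mpr hneg).ne'
    -- Away from zero the spectrum of a compact operator consists of eigenvalues.
    rw [← hc.hasEigenvalue_iff_mem_spectrum hne] at h1
    exact h _ (neg_pos.mpr hneg) h1
  have h1 := ((ContinuousLinearMap.nonneg_iff_isPositive _).mp hnonneg).re_inner_nonneg_left x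
  rw [_root_.neg_apply, inner_neg_left] at h1
  simpa using h1

/-- A compact self-adjoint operator with finitely many positive eigenvalues is nonpositive on
a subspace of finite codimension. -/
theorem exists_finiteDimensional_re_inner_nonpos {D : X →L[ℂ] X} (hc : IsCompactOperator D)
    (hs : IsSelfAdjoint D)
    (hfin : {μ : ℝ | 0 < μ ∧ HasEigenvalue (D : Module.End ℂ X) (μ : ℂ)}.Finite) :
    ∃ F : Submodule ℂ X, FiniteDimensional ℂ F ∧ ∀ x ∈ Fᗮ, (inner ℂ (D x) x).re ≤ 0 := by
  have hsym := isSelfAdjoint_iff_isSymmetric.mp hs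
  let s := {μ : ℝ | 0 < μ ∧ HasEigenvalue (D : Module.End ℂ X) (μ : ℂ)}
  have : Finite s := hfin
  let F : Submodule ℂ X := ⨆ μ : s, eigenspace (D : Module.End ℂ X) ((μ : ℝ) : ℂ)
  have hfd : ∀ μ : s, FiniteDimensional ℂ (eigenspace (D : Module.End ℂ X) ((μ : ℝ) : ℂ)) :=
    fun μ => ContinuousLinearMap.finite_dimensional_eigenspace hc _
      (by exact_mod_cast μ.2.1.ne')
  have hF : FiniteDimensional ℂ F := Submodule.finiteDimensional_iSup _
  refine ⟨F, hF, ?_⟩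
  have hinv : ∀ v ∈ Fᗮ, D v ∈ Fᗮ := by
    intro v hv
    rw [← Submodule.iInf_orthogonal, Submodule.mem_iInf] at hv ⊢
    exact fun μ => hsym.invariant_orthogonalComplement_eigenspace _ v (hv μ)
  let S : Fᗮ →L[ℂ] Fᗮ := D.restrict hinv
  have hSc : IsCompactOperator S := hc.restrict' hinv
  have hSs : IsSelfAdjoint S := isSelfAdjoint_iff_isSymmetric.mpr (hsym.restrict_invariant hinv)
  -- Such an eigenvector would lie both in `F`, the sum of the positive eigenspaces, and in `Fᗮ`.
  have hno : ∀ t : ℝ, 0 < t → ¬ HasEigenvalue (S : Module.End ℂ Fᗮ) (t : ℂ) := by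
    intro t ht h1
    obtain ⟨v, hv⟩ := h1.exists_hasEigenvector
    have hv1 : D (v : X) = (t : ℂ) • (v : X) := congrArg Subtype.val hv.apply_eq_smul
    have hv0 : (v : X) ≠ 0 := fun h => hv.2 (Subtype.ext h)
    have hmem : (v : X) ∈ eigenspace (D : Module.End ℂ X) (t : ℂ) := mem_eigenspace_iff.mpr hv1
    have hts : t ∈ s := ⟨ht, hasEigenvalue_of_hasEigenvector ⟨hmem, hv0⟩⟩
    have hle : eigenspace (D : Module.End ℂ X) (t : ℂ) ≤ F :=
      le_iSup (fun μ : s => eigenspace (D : Module.End ℂ X) ((μ : ℝ) : ℂ)) ⟨t, hts⟩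
    exact hv0 (inner_self_eq_zero.mp (v.2 v (hle hmem)))
  exact fun x hx => re_inner_nonpos_of_forall_hasEigenvalue hSc hSs hno ⟨x, hx⟩

/-- The pencil `PMu = 0`, `u - Pu = z K†KMu` is governed by a compact self-adjoint operator: its
nonzero eigenvalues are the reciprocals of the eigenvalues of a compact self-adjoint operator `D`,
and `D` represents the quadratic form of `M` on the vectors with `PMu = 0`, `u - Pu = K†q`. -/
theorem exists_compact_linearization {P K M : X →L[ℂ] X} (hP : IsSelfAdjoint P)
    (hPP : ∀ x, P (P x) = P x) [FiniteDimensional ℂ P.range] (hKP : ∀ x, K (P x) = 0)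
    (hK : IsCompactOperator K) (hM : IsSelfAdjoint M) :
    ∃ D : X →L[ℂ] X, IsCompactOperator D ∧ IsSelfAdjoint D ∧
      (∀ (μ : ℂ) (q : X), μ ≠ 0 → q ≠ 0 → D q = μ • q →
        ∃ u, u ≠ 0 ∧ P (M u) = 0 ∧ u - P u = μ⁻¹ • adjoint K (K (M u))) ∧
      (∀ (z : ℂ) (u : X), z ≠ 0 → P (M u) = 0 → u - P u = z • adjoint K (K (M u)) →
        D (K (M u)) = z⁻¹ • K (M u)) ∧
      (∀ u q : X, P (M u) = 0 → u - P u = adjoint K q →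
        inner ℂ (D q) q = inner ℂ (M u) u) := by
  have hPin := inner_apply_of_isSelfAdjoint hP
  have hMin := inner_apply_of_isSelfAdjoint hM
  have hPK : ∀ x, P (adjoint K x) = 0 := by
    intro x
    refine ext_inner_right ℂ fun y => ?_
    rw [hPin, adjoint_inner_left, hKP, inner_zero_right, inner_zero_left]
  -- As `M` may be indefinite, `G` can be degenerate on the range of `P`; hence a generalized
  -- inverse `B`, with `E` the projection onto the range of `G`.
  let G : X →L[ℂ] X := P ∘L M ∘L P
  have hGx : ∀ x, G x = P (M (P x)) := fun x => rfl
  have hG : IsSelfAdjoint G := by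
    rw [isSelfAdjoint_iff_isSymmetric]
    intro x y
    simp only [ContinuousLinearMap.coe_coe, hGx]
    rw [hPin, hMin, hPin]
  have hGfin : FiniteDimensional ℂ G.range := by
    refine Submodule.finiteDimensional_of_le (S₂ := P.range) ?_
    rintro _ ⟨x, rfl⟩
    exact ⟨M (P x), rfl⟩
  obtain ⟨B, E, hB, hE, hGB, hBG, hEG, hGE, hEB⟩ := exists_pseudoinverse hG
  have hBin := inner_apply_of_isSelfAdjoint hB
  have hEin := inner_apply_of_isSelfAdjoint hE
  have hPE : ∀ x, P (E x) = E x := by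
    intro x; rw [← hGB, hGx, hPP]
  have hEP : ∀ x, E (P x) = E x := by
    intro x
    refine ext_inner_right ℂ fun y => ?_
    rw [hEin, hPin, hPE, hEin]
  have hPB : ∀ x, P (B x) = B x := by
    intro x; rw [← hEB, hPE]
  have hPMB : ∀ x, P (M (B x)) = E x := by
    intro x; rw [← hGB, hGx, hPB]
  -- The kernel `Q` of `T` collects the `q` for which some vector of the range of `P`, added to
  -- `K†q`, yields a `u` with `PMu = 0`.
  let T : X →L[ℂ] X := (P - E) ∘L M ∘L adjoint K
  have hTx : ∀ x, T x = P (M (adjoint K x)) - E (M (adjoint K x)) := fun x => rfl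
  have hTadj : ∀ x, adjoint T x = K (M (P x - E x)) := by
    intro x
    refine ext_inner_right ℂ fun y => ?_
    rw [adjoint_inner_left, hTx, inner_sub_right, ← hPin, ← hEin, ← inner_sub_left, ← hMin,
      adjoint_inner_right]
  let Q : Submodule ℂ X := T.ker
  have hQ : IsClosed (Q : Set X) := T.isClosed_ker
  have : CompleteSpace Q := hQ.completeSpace_coe
  have hQmem : ∀ x, x ∈ Q ↔ P (M (adjoint K x)) = E (M (adjoint K x)) := by
    intro x
    rw [LinearMap.mem_ker, ContinuousLinearMap.coe_coe, hTx, sub_eq_zero]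
  let R : X →L[ℂ] X := Q.starProjection
  have hR : IsSelfAdjoint R := isSelfAdjoint_starProjection Q
  have hRin := inner_apply_of_isSelfAdjoint hR
  have hRQ : ∀ x, R x ∈ Q := fun x => Submodule.starProjection_apply_mem Q x
  have hReq : ∀ x ∈ Q, R x = x := fun x hx => Submodule.starProjection_eq_self_iff.mpr hx
  have hRfin : FiniteDimensional ℂ (adjoint T).range := by
    refine Submodule.finiteDimensional_of_le (S₂ := P.range.map (K ∘L M).toLinearMap) ?_
    rintro _ ⟨x, rfl⟩
    refine ⟨P (x - E x), ⟨_, rfl⟩, ?_⟩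
    change K (M (P (x - E x))) = adjoint T x
    rw [hTadj, map_sub, hPE]
  -- The orthogonal complement of `ker T` is the closure of the range of `T†`, which is
  -- finite-dimensional and so already closed.
  have hker : ∀ x, R x = 0 → ∃ y, x = K (M (P y - E y)) := by
    intro x hx
    have h1 : x ∈ Qᗮ := (Submodule.starProjection_apply_eq_zero_iff Q).mp hx
    rw [ContinuousLinearMap.orthogonal_ker,
      (Submodule.closed_of_finiteDimensional _).submodule_topologicalClosure_eq] at h1
    obtain ⟨y, rfl⟩ := h1
    exact ⟨y, (hTadj y)⟩
  -- `L` adds the correction in the range of `P` that makes `PMLq = 0` for `q ∈ Q`.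
  let L : X →L[ℂ] X := adjoint K - B ∘L M ∘L adjoint K
  have hLx : ∀ x, L x = adjoint K x - B (M (adjoint K x)) := fun x => rfl
  let D : X →L[ℂ] X := R ∘L K ∘L M ∘L L ∘L R
  have hDx : ∀ x, D x = R (K (M (L (R x)))) := fun x => rfl
  have hPML : ∀ q ∈ Q, P (M (L q)) = 0 := by
    intro q hq
    rw [hLx, map_sub, map_sub, hPMB, (hQmem q).mp hq, sub_self]
  -- The correction is unique only up to `ker G` within the range of `P`. `KM` sends this ambiguity
  -- into the complement of `Q`, so `R` removes it.
  have hRKM : ∀ m, P m = m → P (M m) = 0 → R (K (M m)) = 0 := by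
    intro m hm hm0
    refine ext_inner_right ℂ fun y => ?_
    have hEm : E m = 0 := by
      rw [← hBG, hGx, hm, hm0, map_zero]
    rw [hRin, ← adjoint_inner_right, hMin, inner_zero_left]
    nth_rewrite 1 [← hm]
    rw [hPin, (hQmem _).mp (hRQ y), ← hEin, hEm, inner_zero_left]
  have hcore : ∀ u q, P (M u) = 0 → u - P u = adjoint K q → q ∈ Q ∧ D q = R (K (M u)) ∧
      P (M (L q)) = 0 ∧ P (u - L q) = u - L q := by
    intro u q hPMu hu
    have hqQ : q ∈ Q := by
      rw [hQmem, ← hu, map_sub, map_sub, hPMu, ← hGx, map_sub, ← hEP, hPMu, map_zero,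
        ← hEP (M (P u)), ← hGx, hEG]
    have hm : u - L q = P u + B (M (adjoint K q)) := by
      rw [hLx, ← hu]; abel
    have hPm : P (u - L q) = u - L q := by
      rw [hm, map_add, hPP, hPB]
    refine ⟨hqQ, ?_, hPML q hqQ, hPm⟩
    have h0 := hRKM (u - L q) hPm (by rw [map_sub, map_sub, hPMu, hPML q hqQ, sub_self])
    rw [map_sub, map_sub, map_sub, sub_eq_zero] at h0
    rw [hDx, hReq q hqQ, h0]
  refine ⟨D, ?_, ?_, ?_, ?_, ?_⟩
  · exact (hK.comp_clm (M ∘L L ∘L R)).clm_comp R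
  · rw [isSelfAdjoint_iff_isSymmetric]
    intro x y
    simp only [ContinuousLinearMap.coe_coe, hDx]
    rw [hRin, ← adjoint_inner_right, hMin, ← hRin, ← adjoint_inner_left K, hLx, hLx,
      map_sub, inner_sub_left, inner_sub_right, hBin, hMin _ (B _)]
  · intro μ q hμ hq hDq
    have hqQ : q ∈ Q := by
      have : q = μ⁻¹ • D q := by rw [hDq, smul_smul, inv_mul_cancel₀ hμ, one_smul]
      rw [this]
      exact Q.smul_mem _ (hRQ _)
    rw [hDx, hReq q hqQ] at hDq
    -- `KMLq` equals `μq` only after applying `R`. The discrepancy is `KM(Py - Ey)` with `Py - Ey ∈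
    -- ker G`, so subtracting this vector from `Lq` gives `KMu = μq` and keeps `PMu = 0`.
    have h0 : R (K (M (L q)) - μ • q) = 0 := by
      rw [map_sub, hDq, map_smul, hReq q hqQ, sub_self]
    obtain ⟨y, hy⟩ := hker _ h0
    have hKMu : K (M (L q - (P y - E y))) = μ • q := by
      rw [map_sub, map_sub, ← hy, sub_sub_cancel]
    have hPu : P (L q - (P y - E y)) = L q - (P y - E y) - adjoint K q := by
      rw [map_sub, map_sub, hLx, map_sub, hPK, hPB, hPP, hPE]; abel
    refine ⟨L q - (P y - E y), ?_, ?_, ?_⟩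
    · intro h
      rw [h, map_zero, map_zero] at hKMu
      exact hq ((smul_eq_zero.mp hKMu.symm).resolve_left hμ)
    · have h1 : P (M (P y - E y)) = 0 := by
        have : P y - E y = P (y - E y) := by rw [map_sub, hPE]
        rw [this, ← hGx, map_sub, hGE, sub_self]
      rw [map_sub, map_sub, h1, hPML q hqQ, sub_self]
    · rw [hKMu, hPu, sub_sub_cancel, map_smul, smul_smul, inv_mul_cancel₀ hμ, one_smul]
  · intro z u hz hPMu hu
    obtain ⟨hqQ, hD, -, -⟩ := hcore u (z • K (M u)) hPMu (by rw [hu, map_smul])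
    have hQ' : K (M u) ∈ Q := by
      have := Q.smul_mem z⁻¹ hqQ
      rwa [smul_smul, inv_mul_cancel₀ hz, one_smul] at this
    rw [map_smul, hReq _ hQ'] at hD
    rw [← hD, smul_smul, inv_mul_cancel₀ hz, one_smul, hD]
  · intro u q hPMu hu
    obtain ⟨hqQ, -, hPML', hPm⟩ := hcore u q hPMu hu
    -- `u` and `Lq` differ by a vector of the range of `P`, to which both `Mu` and `MLq` are
    -- orthogonal.
    have h1 : inner ℂ (M (L q)) (P u) = 0 := by rw [← hPin, hPML', inner_zero_left]
    have h2 : inner ℂ (u - L q) (M u) = 0 := by rw [← hPm, hPin, hPMu, inner_zero_right]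
    rw [inner_sub_left, sub_eq_zero] at h2
    rw [hDx, hReq q hqQ, hRin, hReq q hqQ, ← adjoint_inner_right, ← hu, inner_sub_right, h1,
      sub_zero, hMin, ← h2, ← hMin]

end Abstract

/-! ### The linear pencil `1 - P - z (P + K†K) M` -/

section Pencil

open Module.End ContinuousLinearMap

variable {X : Type*} [NormedAddCommGroup X] [InnerProductSpace ℂ X] [CompleteSpace X]

theorem isCompactOperator_of_finiteDimensional_range {Y : Type*}
    [NormedAddCommGroup Y] [InnerProductSpace ℂ Y] (A : Y →L[ℂ] Y) [FiniteDimensional ℂ A.range] : IsCompactOperator A := by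
  have := FiniteDimensional.proper ℂ A.range
  have h : IsCompactOperator (A.codRestrict A.range fun x => ⟨x, rfl⟩) :=
    isCompactOperator_of_locallyCompactSpace_dom _
  exact h.clm_comp A.range.subtypeL

/-- The operator `P + z (P + K†K) M`. -/
noncomputable def pencil (P K M : X →L[ℂ] X) (z : ℂ) : X →L[ℂ] X :=
  P + z • (P + adjoint K ∘L K) ∘L M

theorem pencil_apply (P K M : X →L[ℂ] X) (z : ℂ) (u : X) :
    pencil P K M z u = P u + z • (P (M u) + adjoint K (K (M u))) := rfl

/-- The points where the pencil `1 - P - z (P + K†K) M` is not injective. -/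
def pencilSpectrum (P K M : X →L[ℂ] X) : Set ℂ :=
  {z | ∃ u, u ≠ 0 ∧ pencil P K M z u = u}

/-- The orthogonal projection `P` and the operators `K`, `M` of the pencil `1 - P - z (P + K†K) M`:
`P` has finite rank, `K` is compact and vanishes on the range of `P`, and `M` is self-adjoint. -/
structure IsPencil (P K M : X →L[ℂ] X) : Prop where
  isSelfAdjoint_proj : IsSelfAdjoint P
  proj_proj : ∀ x, P (P x) = P x
  finiteDimensional : FiniteDimensional ℂ P.range
  comp_proj : ∀ x, K (P x) = 0
  isCompact : IsCompactOperator K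
  isSelfAdjoint : IsSelfAdjoint M

variable {P K M : X →L[ℂ] X}

theorem IsPencil.proj_adjoint (h : IsPencil P K M) (x : X) : P (adjoint K x) = 0 := by
  refine ext_inner_right ℂ fun y => ?_
  rw [inner_apply_of_isSelfAdjoint h.isSelfAdjoint_proj, adjoint_inner_left, h.comp_proj,
    inner_zero_right, inner_zero_left]

theorem pencil_neg (z : ℂ) : pencil P K (-M) z = pencil P K M (-z) := by
  ext u
  simp only [pencil_apply, _root_.neg_apply, map_neg]
  module

theorem IsPencil.isCompactOperator_pencil (h : IsPencil P K M) (z : ℂ) :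
    IsCompactOperator (pencil P K M z) := by
  have := h.finiteDimensional
  have hP : IsCompactOperator P := isCompactOperator_of_finiteDimensional_range P
  exact hP.add (((hP.add (h.isCompact.clm_comp (adjoint K))).comp_clm M).smul z)

/-- Since `PK† = 0`, applying `P` splits the equation into its two components. At `z = 0` the
condition `PMu = 0` would be lost. -/
theorem IsPencil.pencil_eq_iff (h : IsPencil P K M) {z : ℂ} (hz : z ≠ 0) {u : X} :
    pencil P K M z u = u ↔ P (M u) = 0 ∧ u - P u = z • adjoint K (K (M u)) := by
  rw [pencil_apply]
  constructor
  · intro hu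
    have h1 := congrArg P hu
    rw [map_add, map_smul, map_add, h.proj_proj, h.proj_proj, h.proj_adjoint, add_zero,
      add_eq_left, smul_eq_zero] at h1
    have h2 := h1.resolve_left hz
    refine ⟨h2, ?_⟩
    rw [h2, zero_add] at hu
    rw [sub_eq_iff_eq_add', hu]
  · rintro ⟨h1, h2⟩
    rw [h1, zero_add, ← h2]; abel

/-- The two hypotheses make `KMu` a genuine eigenvector: if `KMu = 0`, then `PMu = 0` gives `Mu =
0`, while `u = Pu`, so `u = 0`. -/
theorem IsPencil.exists_linearization (h : IsPencil P K M)
    (hinj : ∀ F, P F = 0 → K F = 0 → F = 0) (hker : ∀ n, P n = n → M n = 0 → n = 0) :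
    ∃ D : X →L[ℂ] X, IsCompactOperator D ∧ IsSelfAdjoint D ∧
      ∀ z, z ≠ 0 → z ∈ pencilSpectrum P K M → HasEigenvalue (D : Module.End ℂ X) z⁻¹ := by
  have := h.finiteDimensional
  obtain ⟨D, hD, hDs, -, h1, -⟩ := exists_compact_linearization h.isSelfAdjoint_proj h.proj_proj
    h.comp_proj h.isCompact h.isSelfAdjoint
  refine ⟨D, hD, hDs, ?_⟩
  rintro z hz ⟨u, hu0, hu⟩
  obtain ⟨h2, h3⟩ := (h.pencil_eq_iff hz).mp hu
  refine hasEigenvalue_of_hasEigenvector (x := K (M u))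
    ⟨mem_eigenspace_iff.mpr (h1 z u hz h2 h3), fun hK => hu0 ?_⟩
  have hM := hinj _ h2 hK
  rw [hK, map_zero, smul_zero, sub_eq_zero] at h3
  exact hker u h3.symm hM

theorem IsPencil.im_eq_zero (h : IsPencil P K M)
    (hinj : ∀ F, P F = 0 → K F = 0 → F = 0) (hker : ∀ n, P n = n → M n = 0 → n = 0)
    {z : ℂ} (hz : z ∈ pencilSpectrum P K M) : z.im = 0 := by
  obtain ⟨D, hD, hDs, h1⟩ := h.exists_linearization hinj hker
  rcases eq_or_ne z 0 with rfl | hz0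
  · rfl
  have h2 := (isSelfAdjoint_iff_isSymmetric.mp hDs).conj_eigenvalue_eq_self (h1 z hz0 hz)
  rw [map_inv₀, inv_inj] at h2
  exact Complex.conj_eq_iff_im.mp h2

theorem IsPencil.finite_inter_closedBall (h : IsPencil P K M)
    (hinj : ∀ F, P F = 0 → K F = 0 → F = 0) (hker : ∀ n, P n = n → M n = 0 → n = 0)
    (r : ℝ) : {z ∈ pencilSpectrum P K M | ‖z‖ ≤ r}.Finite := by
  obtain ⟨D, hD, hDs, h1⟩ := h.exists_linearization hinj hker
  -- The bound `‖z‖ ≤ r` becomes a lower bound for `‖z⁻¹‖`; the maximum with `1` keeps it positive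
  -- for every `r`. The point `0` is added by hand.
  have h2 := finite_eigenvalues_of_le_norm hD hDs (ε := (max r 1)⁻¹) (by positivity)
  refine ((h2.image (·⁻¹)).insert 0).subset ?_
  rintro z ⟨hz, hzr⟩
  rcases eq_or_ne z 0 with rfl | hz0
  · exact Or.inl rfl
  refine Or.inr ⟨z⁻¹, ⟨h1 z hz0 hz, ?_⟩, inv_inv z⟩
  rw [norm_inv]
  exact inv_anti₀ (norm_pos_iff.mpr hz0) (hzr.trans (le_max_left _ _))

/-- If the quadratic form of `M` is positive on an infinite-dimensional space of vectors `u` with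
`u - Pu` in the range of `K†`, then the pencil has infinitely many positive eigenvalues. -/
theorem IsPencil.infinite_pos (h : IsPencil P K M) {W : Type*} [AddCommGroup W] [Module ℂ W]
    (hW : ¬ FiniteDimensional ℂ W) (a b : W →ₗ[ℂ] X)
    (hab : ∀ w, a w - P (a w) = adjoint K (b w))
    (hpos : ∀ w, w ≠ 0 → 0 < (inner ℂ (M (a w)) (a w)).re) :
    {t : ℝ | 0 < t ∧ (t : ℂ) ∈ pencilSpectrum P K M}.Infinite := by
  have := h.finiteDimensional
  intro hfin
  obtain ⟨D, hD, hDs, h1, -, h2⟩ := exists_compact_linearization h.isSelfAdjoint_proj h.proj_proj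
    h.comp_proj h.isCompact h.isSelfAdjoint
  have hfin' : {μ : ℝ | 0 < μ ∧ HasEigenvalue (D : Module.End ℂ X) (μ : ℂ)}.Finite := by
    refine (hfin.image (·⁻¹)).subset ?_
    rintro μ ⟨hμ, hev⟩
    have hμ0 : (μ : ℂ) ≠ 0 := by exact_mod_cast hμ.ne'
    obtain ⟨q, hq⟩ := hev.exists_hasEigenvector
    obtain ⟨u, hu, hu1, hu2⟩ := h1 μ q hμ0 hq.2 hq.apply_eq_smul
    refine ⟨μ⁻¹, ⟨inv_pos.mpr hμ, u, hu, ?_⟩, inv_inv μ⟩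
    rw [Complex.ofReal_inv]
    exact (h.pencil_eq_iff (inv_ne_zero hμ0)).mpr ⟨hu1, hu2⟩
  obtain ⟨F, hF, hFneg⟩ := exists_finiteDimensional_re_inner_nonpos hD hDs hfin'
  -- The constraints `PM(aw) = 0` and `bw ⊥ F` are finitely many, so some nonzero `w` satisfies them
  -- all; there `M` is positive and `D` nonpositive.
  let c : W →ₗ[ℂ] P.range × F :=
    ((P.rangeRestrict.toLinearMap ∘ₗ M.toLinearMap ∘ₗ a).prod
      (F.orthogonalProjectionOnto.toLinearMap ∘ₗ b))
  have hc : ¬ Function.Injective c := fun hinj => hW (FiniteDimensional.of_injective c hinj)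
  rw [← LinearMap.ker_eq_bot, Submodule.eq_bot_iff] at hc
  push Not at hc
  obtain ⟨w, hw, hw0⟩ := hc
  have hw1 : P (M (a w)) = 0 := congrArg (fun p : P.range × F => (p.1 : X)) hw
  have hw2 : F.orthogonalProjectionOnto (b w) = 0 :=
    congrArg (fun p : P.range × F => p.2) hw
  have h3 := hFneg (b w) (F.orthogonalProjectionOnto_eq_zero_iff.mp hw2)
  rw [h2 (a w) (b w) hw1 (hab w)] at h3
  exact absurd (hpos w hw0) (not_lt.mpr h3)

/-- Fredholm alternative at the value `1` for the compact operator `pencil P K M z`. -/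
theorem IsPencil.exists_inverse (h : IsPencil P K M) {z : ℂ} (hz : z ∉ pencilSpectrum P K M) :
    ∃ R : X →L[ℂ] X, (∀ x, R x - pencil P K M z (R x) = x) ∧
      ∀ x, R (x - pencil P K M z x) = x := by
  have h1 : (1 : ℂ) ∈ resolventSet ℂ (pencil P K M z) := by
    refine ((h.isCompactOperator_pencil z).hasEigenvalue_or_mem_resolventSet
      one_ne_zero).resolve_left fun hev => hz ?_
    obtain ⟨u, hu⟩ := hev.exists_hasEigenvector
    exact ⟨u, hu.2, by simpa using hu.apply_eq_smul⟩
  rw [spectrum.mem_resolventSet_iff, map_one] at h1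
  obtain ⟨U, hU⟩ := h1
  refine ⟨(U⁻¹ : (X →L[ℂ] X)ˣ), fun x => ?_, fun x => ?_⟩
  · have : ((U : X →L[ℂ] X) * (U⁻¹ : (X →L[ℂ] X)ˣ)) x = x := by rw [Units.mul_inv]; rfl
    rwa [hU] at this
  · have : (((U⁻¹ : (X →L[ℂ] X)ˣ) : X →L[ℂ] X) * U) x = x := by rw [Units.inv_mul]; rfl
    rwa [hU] at this

theorem IsPencil.finiteDimensional_fixed (h : IsPencil P K M) (z : ℂ) :
    FiniteDimensional ℂ (eigenspace (pencil P K M z).toLinearMap 1) :=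
  ContinuousLinearMap.finite_dimensional_eigenspace (h.isCompactOperator_pencil z) 1 one_ne_zero

end Pencil

/-! ### The Volterra operator on `L²(-1, 1)` -/

section Volterra

/-- Lebesgue measure on `(-1, 1)`. -/
noncomputable abbrev unitMeasure : Measure ℝ := volume.restrict (Ioo (-1 : ℝ) 1)

/-- The complex Hilbert space `L²(-1, 1)`. -/
abbrev UnitL2 : Type := Lp ℂ 2 unitMeasure

/-- The primitive of `f` that vanishes at `-1`. -/
noncomputable def prim (f : ℝ → ℂ) (x : ℝ) : ℂ := ∫ ξ in (-1 : ℝ)..x, f ξ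

theorem prim_neg_one (f : ℝ → ℂ) : prim f (-1) = 0 := intervalIntegral.integral_same

theorem MeasureTheory.MemLp.intervalIntegrable_unit {f : ℝ → ℂ} (hf : MemLp f 2 unitMeasure)
    {a b : ℝ} (ha : a ∈ Icc (-1 : ℝ) 1) (hb : b ∈ Icc (-1 : ℝ) 1) :
    IntervalIntegrable f volume a b := by
  have h : IntervalIntegrable f volume (-1) 1 := by
    rw [intervalIntegrable_iff_integrableOn_Ioo_of_le (by norm_num)]
    exact hf.integrable (by norm_num)
  refine h.mono_set ?_
  rw [uIcc_of_le (by norm_num : (-1 : ℝ) ≤ 1)]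
  exact uIcc_subset_Icc ha hb

theorem neg_one_mem_Icc : (-1 : ℝ) ∈ Icc (-1 : ℝ) 1 := by simp

theorem one_mem_Icc : (1 : ℝ) ∈ Icc (-1 : ℝ) 1 := by simp

theorem setIntegral_unit {f : ℝ → ℂ} {a b : ℝ} (ha : a ∈ Icc (-1 : ℝ) 1)
    (hb : b ∈ Icc (-1 : ℝ) 1) (hab : a ≤ b) :
    ∫ ξ in Ioo a b, f ξ ∂unitMeasure = ∫ ξ in a..b, f ξ := by
  rw [Measure.restrict_restrict_of_subset (Ioo_subset_Ioo ha.1 hb.2),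
    intervalIntegral.integral_of_le hab, integral_Ioc_eq_integral_Ioo]

theorem prim_one (f : ℝ → ℂ) : prim f 1 = ∫ ξ, f ξ ∂unitMeasure := by
  rw [prim, intervalIntegral.integral_of_le (by norm_num), integral_Ioc_eq_integral_Ioo]

theorem prim_congr {f g : ℝ → ℂ} (h : f =ᵐ[unitMeasure] g) {x : ℝ} (hx : x ∈ Icc (-1 : ℝ) 1) :
    prim f x = prim g x := by
  rw [prim, prim, ← setIntegral_unit neg_one_mem_Icc hx hx.1,
    ← setIntegral_unit neg_one_mem_Icc hx hx.1]
  exact integral_congr_ae (ae_restrict_of_ae h)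

theorem prim_sub {f : ℝ → ℂ} (hf : MemLp f 2 unitMeasure) {x y : ℝ} (hx : x ∈ Icc (-1 : ℝ) 1)
    (hy : y ∈ Icc (-1 : ℝ) 1) : prim f x - prim f y = ∫ ξ in y..x, f ξ :=
  intervalIntegral.integral_interval_sub_left (hf.intervalIntegrable_unit neg_one_mem_Icc hx)
    (hf.intervalIntegrable_unit neg_one_mem_Icc hy)

/-- Cauchy–Schwarz against the indicator of the interval between `y` and `x`. This Hölder bound
gives both boundedness and compactness of the Volterra operator. -/
theorem norm_prim_sub_le (f : UnitL2) {x y : ℝ} (hx : x ∈ Icc (-1 : ℝ) 1)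
    (hy : y ∈ Icc (-1 : ℝ) 1) : ‖prim f x - prim f y‖ ≤ √|x - y| * ‖f‖ := by
  wlog hxy : y ≤ x generalizing x y
  · rw [norm_sub_rev, abs_sub_comm]
    exact this hy hx (not_le.mp hxy).le
  rw [prim_sub (Lp.memLp f) hx hy, ← setIntegral_unit hy hx hxy,
    ← L2.inner_indicatorConstLp_one (𝕜 := ℂ) measurableSet_Ioo (by finiteness) f]
  refine (norm_inner_le_norm _ _).trans (mul_le_mul_of_nonneg_right (le_of_eq ?_) (norm_nonneg _))
  rw [norm_indicatorConstLp (by norm_num) (by norm_num), measureReal_restrict_apply measurableSet_Ioo,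
    inter_eq_left.mpr (Ioo_subset_Ioo hy.1 hx.2), Real.volume_real_Ioo_of_le hxy,
    abs_of_nonneg (sub_nonneg.mpr hxy), Real.sqrt_eq_rpow]
  simp

theorem continuousOn_prim {f : ℝ → ℂ} (hf : MemLp f 2 unitMeasure) :
    ContinuousOn (prim f) (Icc (-1) 1) := by
  have := intervalIntegral.continuousOn_primitive_interval' (μ := volume) (f := f)
    (hf.intervalIntegrable_unit neg_one_mem_Icc one_mem_Icc) (a := -1) (by simp)
  rwa [uIcc_of_le (by norm_num)] at this

theorem memLp_of_continuousOn {f : ℝ → ℂ} (hf : ContinuousOn f (Icc (-1) 1)) :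
    MemLp f 2 unitMeasure := by
  obtain ⟨C, hC⟩ := isCompact_Icc.exists_bound_of_continuousOn hf
  refine MemLp.of_bound ((hf.mono Ioo_subset_Icc_self).aestronglyMeasurable measurableSet_Ioo) C ?_
  filter_upwards [ae_restrict_mem measurableSet_Ioo] with x hx
  exact hC x (Ioo_subset_Icc_self hx)

theorem hasDerivWithinAt_prim {f : ℝ → ℂ} (hf : ContinuousOn f (Icc (-1) 1)) {x : ℝ}
    (hx : x ∈ Icc (-1 : ℝ) 1) : HasDerivWithinAt (prim f) (f x) (Icc (-1) 1) x := by
  have : Fact (x ∈ Icc (-1 : ℝ) 1) := ⟨hx⟩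
  have hm : StronglyMeasurableAtFilter f (𝓝[Icc (-1) 1] x) volume :=
    hf.stronglyMeasurableAtFilter_nhdsWithin measurableSet_Icc x
  exact intervalIntegral.integral_hasDerivWithinAt_right
    ((memLp_of_continuousOn hf).intervalIntegrable_unit neg_one_mem_Icc hx) hm (hf x hx)

theorem memLp_prim_comp {f : ℝ → ℂ} (hf : MemLp f 2 unitMeasure) {r : ℝ → ℝ} (hr : Measurable r)
    (hr' : ∀ x, r x ∈ Icc (-1 : ℝ) 1) : MemLp (fun x => prim f (r x)) 2 unitMeasure := by
  obtain ⟨C, hC⟩ := isCompact_Icc.exists_bound_of_continuousOn (continuousOn_prim hf)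
  have h1 : Continuous (IccExtend (by norm_num : (-1 : ℝ) ≤ 1) ((Icc (-1 : ℝ) 1).domRestrict (prim f))) :=
    (continuousOn_prim hf).domRestrict.Icc_extend'
  have h2 : (fun x => prim f (r x)) =
      IccExtend (by norm_num : (-1 : ℝ) ≤ 1) ((Icc (-1 : ℝ) 1).domRestrict (prim f)) ∘ r := by
    ext x
    rw [Function.comp_apply, IccExtend_of_mem _ _ (hr' x)]; rfl
  refine MemLp.of_bound ?_ C (Eventually.of_forall fun x => hC _ (hr' x))
  rw [h2]
  exact (h1.measurable.comp hr).aestronglyMeasurable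

theorem norm_le_of_ae_bound_unit {f : UnitL2} {C : ℝ} (hC : 0 ≤ C)
    (h : ∀ᵐ x ∂unitMeasure, ‖f x‖ ≤ C) : ‖f‖ ≤ √2 * C := by
  have := Lp.norm_le_of_ae_bound hC h
  have h2 : (measureUnivNNReal unitMeasure : ℝ) = 2 := by
    have : measureUnivNNReal unitMeasure = 2 := by
      rw [← ENNReal.coe_inj, coe_measureUnivNNReal]
      rw [Measure.restrict_apply_univ, Real.volume_Ioo]
      norm_num
    rw [this]; rfl
  rw [h2] at this
  rw [Real.sqrt_eq_rpow]
  simpa using this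

/-- The operator that takes `f` to the function `x ↦ ∫ ξ in -1..r x, f ξ`. -/
noncomputable def primComp (r : ℝ → ℝ) (hr : Measurable r) (hr' : ∀ x, r x ∈ Icc (-1 : ℝ) 1) :
    UnitL2 →L[ℂ] UnitL2 :=
  LinearMap.mkContinuous
    { toFun := fun f => MemLp.toLp _ (memLp_prim_comp (Lp.memLp f) hr hr')
      map_add' := by
        intro f g
        rw [← MemLp.toLp_add, MemLp.toLp_eq_toLp_iff]
        refine Eventually.of_forall fun x => ?_
        simp only [Pi.add_apply]
        rw [prim_congr (Lp.coeFn_add f g) (hr' x)]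
        exact intervalIntegral.integral_add
          ((Lp.memLp f).intervalIntegrable_unit neg_one_mem_Icc (hr' x))
          ((Lp.memLp g).intervalIntegrable_unit neg_one_mem_Icc (hr' x))
      map_smul' := by
        intro c f
        rw [RingHom.id_apply, ← MemLp.toLp_const_smul, MemLp.toLp_eq_toLp_iff]
        refine Eventually.of_forall fun x => ?_
        simp only [Pi.smul_apply]
        rw [prim_congr (Lp.coeFn_smul c f) (hr' x)]
        exact intervalIntegral.integral_smul c _ }
    -- One factor is the square root of the length of `(-1, 1)`, the other bounds `√(r x + 1)`.
    (√2 * √2) (by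
      intro f
      rw [mul_assoc]
      refine norm_le_of_ae_bound_unit (by positivity) ?_
      filter_upwards [MemLp.coeFn_toLp (memLp_prim_comp (Lp.memLp f) hr hr')] with x hx
      rw [LinearMap.coe_mk, AddHom.coe_mk, hx]
      have h1 := norm_prim_sub_le f (hr' x) neg_one_mem_Icc
      rw [prim_neg_one, sub_zero] at h1
      refine h1.trans (mul_le_mul_of_nonneg_right (Real.sqrt_le_sqrt ?_) (norm_nonneg _))
      rw [abs_le]; constructor <;> linarith [(hr' x).1, (hr' x).2])

theorem coeFn_primComp {r : ℝ → ℝ} (hr : Measurable r) (hr' : ∀ x, r x ∈ Icc (-1 : ℝ) 1)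
    (f : UnitL2) : primComp r hr hr' f =ᵐ[unitMeasure] fun x => prim f (r x) :=
  MemLp.coeFn_toLp (memLp_prim_comp (Lp.memLp f) hr hr')

theorem norm_primComp_sub_le {r s : ℝ → ℝ} (hr : Measurable r) (hr' : ∀ x, r x ∈ Icc (-1 : ℝ) 1)
    (hs : Measurable s) (hs' : ∀ x, s x ∈ Icc (-1 : ℝ) 1) {δ : ℝ}
    (h : ∀ x, |r x - s x| ≤ δ) : ‖primComp r hr hr' - primComp s hs hs'‖ ≤ √2 * √δ := by
  refine ContinuousLinearMap.opNorm_le_bound _ (by positivity) fun f => ?_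
  rw [mul_assoc]
  refine norm_le_of_ae_bound_unit (by positivity) ?_
  filter_upwards [coeFn_primComp hr hr' f, coeFn_primComp hs hs' f,
    Lp.coeFn_sub (primComp r hr hr' f) (primComp s hs hs' f)] with x h1 h2 h3
  rw [_root_.sub_apply, h3, Pi.sub_apply, h1, h2]
  exact (norm_prim_sub_le f (hr' x) (hs' x)).trans
    (mul_le_mul_of_nonneg_right (Real.sqrt_le_sqrt (h x)) (norm_nonneg _))

/-- The image of `f` depends only on the values of `prim f` at the finitely many points of `range
r`. -/
theorem finiteDimensional_range_primComp {r : ℝ → ℝ} (hr : Measurable r)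
    (hr' : ∀ x, r x ∈ Icc (-1 : ℝ) 1) (hfin : (range r).Finite) :
    FiniteDimensional ℂ (primComp r hr hr').range := by
  have : Finite (range r) := hfin
  let A : UnitL2 →ₗ[ℂ] (range r → ℂ) :=
    { toFun := fun f y => prim f y
      map_add' := by
        intro f g
        ext ⟨_, x, rfl⟩
        simp only [Pi.add_apply]
        rw [prim_congr (Lp.coeFn_add f g) (hr' x)]
        exact intervalIntegral.integral_add
          ((Lp.memLp f).intervalIntegrable_unit neg_one_mem_Icc (hr' x))
          ((Lp.memLp g).intervalIntegrable_unit neg_one_mem_Icc (hr' x))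
      map_smul' := by
        intro c f
        ext ⟨_, x, rfl⟩
        simp only [Pi.smul_apply, RingHom.id_apply]
        rw [prim_congr (Lp.coeFn_smul c f) (hr' x)]
        exact intervalIntegral.integral_smul c _ }
  have hA : (LinearMap.ker A).CoFG :=
    Submodule.range_fg_iff_ker_cofg.mp (IsNoetherian.noetherian _)
  have hle : LinearMap.ker A ≤ LinearMap.ker (primComp r hr hr').toLinearMap := by
    intro f hf
    rw [LinearMap.mem_ker, ContinuousLinearMap.coe_coe, Lp.eq_zero_iff_ae_eq_zero]
    filter_upwards [coeFn_primComp hr hr' f] with x hx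
    rw [hx]
    exact congrFun hf ⟨r x, x, rfl⟩
  exact Module.Finite.iff_fg.mpr (Submodule.range_fg_iff_ker_cofg.mpr (hA.of_le hle))

/-- The retraction of the line onto `[-1, 1]`. -/
noncomputable def clampUnit (x : ℝ) : ℝ := max (-1) (min x 1)

theorem clampUnit_mem (x : ℝ) : clampUnit x ∈ Icc (-1 : ℝ) 1 :=
  ⟨le_max_left _ _, max_le (by norm_num) (min_le_right _ _)⟩

theorem clampUnit_of_mem {x : ℝ} (hx : x ∈ Icc (-1 : ℝ) 1) : clampUnit x = x := by
  rw [clampUnit, min_eq_left hx.2, max_eq_right hx.1]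

theorem measurable_clampUnit : Measurable clampUnit :=
  measurable_const.max (measurable_id.min measurable_const)

theorem abs_clampUnit_sub_le (x y : ℝ) : |clampUnit x - clampUnit y| ≤ |x - y| := by
  have h1 := abs_max_sub_max_le_max (-1) (min x 1) (-1) (min y 1)
  have h2 := abs_min_sub_min_le_max x 1 y 1
  rw [sub_self, abs_zero] at h1 h2
  exact h1.trans (max_le (abs_nonneg _) (h2.trans (max_le le_rfl (abs_nonneg _))))

/-- The Volterra operator `f ↦ ∫ ξ in -1..x, f ξ`. -/
noncomputable def volterra : UnitL2 →L[ℂ] UnitL2 :=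
  primComp clampUnit measurable_clampUnit clampUnit_mem

theorem coeFn_volterra (f : UnitL2) : volterra f =ᵐ[unitMeasure] prim f := by
  filter_upwards [coeFn_primComp measurable_clampUnit clampUnit_mem f,
    ae_restrict_mem measurableSet_Ioo] with x hx hxI
  rw [volterra, hx, clampUnit_of_mem (Ioo_subset_Icc_self hxI)]

/-- Rounding the upper limit of integration down to a grid of mesh `1/(n+1)` gives finite-rank
operators, which converge in norm by the Hölder bound. -/
theorem isCompactOperator_volterra : IsCompactOperator volterra := by
  let r : ℕ → ℝ → ℝ := fun n x => clampUnit (⌊clampUnit x * (n + 1)⌋ / (n + 1))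
  have hr : ∀ n, Measurable (r n) := fun n =>
    measurable_clampUnit.comp ((measurable_from_top.comp
      (Int.measurable_floor.comp (measurable_clampUnit.mul_const _))).div_const _)
  have hr' : ∀ n x, r n x ∈ Icc (-1 : ℝ) 1 := fun n x => clampUnit_mem _
  have hfin : ∀ n, (range (r n)).Finite := by
    intro n
    refine ((Set.finite_Icc (-(n + 1) : ℤ) (n + 1)).image
      (fun k : ℤ => clampUnit (k / (n + 1)))).subset ?_
    rintro _ ⟨x, rfl⟩
    refine ⟨⌊clampUnit x * (n + 1)⌋, ⟨?_, ?_⟩, rfl⟩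
    · rw [Int.le_floor]; push_cast
      nlinarith [(clampUnit_mem x).1]
    · rw [← Int.cast_le (R := ℝ)]
      refine (Int.floor_le _).trans ?_
      push_cast
      nlinarith [(clampUnit_mem x).2]
  have hdist : ∀ n x, |r n x - clampUnit x| ≤ 1 / ((n : ℝ) + 1) := by
    intro n x
    have hn : (0 : ℝ) < n + 1 := by positivity
    have h1 : r n x - clampUnit x = clampUnit (⌊clampUnit x * (n + 1)⌋ / (n + 1)) -
        clampUnit (clampUnit x) := by rw [clampUnit_of_mem (clampUnit_mem x)]
    rw [h1]
    refine (abs_clampUnit_sub_le _ _).trans ?_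
    have h2 : (⌊clampUnit x * (n + 1)⌋ : ℝ) / (n + 1) - clampUnit x =
        -(Int.fract (clampUnit x * (n + 1)) / (n + 1)) := by
      rw [Int.fract]; field_simp; ring
    rw [h2, abs_neg, abs_of_nonneg (div_nonneg (Int.fract_nonneg _) hn.le)]
    exact div_le_div_of_nonneg_right (Int.fract_lt_one _).le hn.le
  refine isCompactOperator_of_tendsto (l := atTop) (F := fun n => primComp (r n) (hr n) (hr' n))
    ?_ (Eventually.of_forall fun n => ?_)
  · rw [tendsto_iff_norm_sub_tendsto_zero]
    refine squeeze_zero (fun _ => norm_nonneg _)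
      (fun n => norm_primComp_sub_le (hr n) (hr' n) measurable_clampUnit clampUnit_mem (hdist n)) ?_
    have := (tendsto_one_div_add_atTop_nhds_zero_nat (𝕜 := ℝ)).sqrt.const_mul (√2)
    simpa using this
  · have := finiteDimensional_range_primComp (hr n) (hr' n) (hfin n)
    exact isCompactOperator_of_finiteDimensional_range _

end Volterra

/-! ### Adjoint of the Volterra operator and projection onto the affine functions -/

section Volterra

open ContinuousLinearMap

/-- The constant function `1` in `L²(-1, 1)`. -/
noncomputable def oneL2 : UnitL2 := MemLp.toLp (fun _ => (1 : ℂ)) (memLp_const 1)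

theorem coeFn_oneL2 : oneL2 =ᵐ[unitMeasure] fun _ => (1 : ℂ) := MemLp.coeFn_toLp _

theorem inner_oneL2 (f : UnitL2) : inner ℂ oneL2 f = prim f 1 := by
  rw [prim_one, L2.inner_def]
  refine integral_congr_ae ?_
  filter_upwards [coeFn_oneL2] with x hx
  simp [hx]

theorem inner_eq_intervalIntegral (f g : UnitL2) {u v : ℝ → ℂ} (hf : f =ᵐ[unitMeasure] u)
    (hg : g =ᵐ[unitMeasure] v) :
    inner ℂ f g = ∫ x in (-1 : ℝ)..1, (starRingEnd ℂ) (u x) * v x := by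
  rw [L2.inner_def, intervalIntegral.integral_of_le (by norm_num), integral_Ioc_eq_integral_Ioo]
  refine integral_congr_ae ?_
  filter_upwards [hf, hg] with x h1 h2
  rw [h1, h2, RCLike.inner_apply, mul_comm]

theorem prim_conj (f : ℝ → ℂ) (x : ℝ) :
    prim (fun ξ => (starRingEnd ℂ) (f ξ)) x = (starRingEnd ℂ) (prim f x) := by
  simp only [prim, intervalIntegral, map_sub, integral_conj]

/-- Integration by parts, done for bounded continuous functions and extended by density. Only the
boundary term at `1` survives, so `V + V†` has rank one. -/
theorem inner_volterra_add (f g : UnitL2) :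
    inner ℂ (volterra f) g + inner ℂ f (volterra g) = inner ℂ f oneL2 * inner ℂ oneL2 g := by
  refine DenseRange.induction_on₂ (BoundedContinuousFunction.toLp_denseRange ℂ unitMeasure ℂ
    (p := 2) (by norm_num)) (p := fun f g : UnitL2 => inner ℂ (volterra f) g +
      inner ℂ f (volterra g) = inner ℂ f oneL2 * inner ℂ oneL2 g) ?_ ?_ f g
  · refine isClosed_eq ?_ ?_ <;> fun_prop
  intro φ γ
  have hφ := BoundedContinuousFunction.coeFn_toLp (p := 2) unitMeasure ℂ φ
  have hγ := BoundedContinuousFunction.coeFn_toLp (p := 2) unitMeasure ℂ γ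
  set f : UnitL2 := BoundedContinuousFunction.toLp 2 unitMeasure ℂ φ
  set g : UnitL2 := BoundedContinuousFunction.toLp 2 unitMeasure ℂ γ
  have hV : ∀ {h : UnitL2} {χ : ℝ → ℂ}, h =ᵐ[unitMeasure] χ →
      volterra h =ᵐ[unitMeasure] prim χ := by
    intro h χ hh
    filter_upwards [coeFn_volterra h, ae_restrict_mem measurableSet_Ioo] with x hx hxI
    rw [hx, prim_congr hh (Ioo_subset_Icc_self hxI)]
  have hφc : Continuous fun x => (starRingEnd ℂ) (φ x) := Complex.continuous_conj.comp φ.continuous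
  have hd1 : ∀ x ∈ uIcc (-1 : ℝ) 1,
      HasDerivAt (prim fun ξ => (starRingEnd ℂ) (φ ξ)) ((starRingEnd ℂ) (φ x)) x := fun x _ =>
    hφc.integral_hasStrictDerivAt _ _ |>.hasDerivAt
  have hd2 : ∀ x ∈ uIcc (-1 : ℝ) 1, HasDerivAt (prim γ) (γ x) x := fun x _ =>
    γ.continuous.integral_hasStrictDerivAt _ _ |>.hasDerivAt
  have hc1 : Continuous (prim fun ξ => (starRingEnd ℂ) (φ ξ)) :=
    continuous_iff_continuousAt.mpr fun x =>
      (hφc.integral_hasStrictDerivAt (-1) x).hasDerivAt.continuousAt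
  have hc2 : Continuous (prim γ) := continuous_iff_continuousAt.mpr fun x =>
      (γ.continuous.integral_hasStrictDerivAt (-1) x).hasDerivAt.continuousAt
  have key := intervalIntegral.integral_deriv_mul_eq_sub hd1 hd2
    (hφc.intervalIntegrable _ _) (γ.continuous.intervalIntegrable _ _)
  have hi1 : IntervalIntegrable (fun x => (starRingEnd ℂ) (φ x) * prim γ x) volume (-1) 1 :=
    (hφc.mul hc2).intervalIntegrable _ _
  have hi2 : IntervalIntegrable (fun x => prim (fun ξ => (starRingEnd ℂ) (φ ξ)) x * γ x)
    volume (-1) 1 := (hc1.mul γ.continuous).intervalIntegrable _ _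
  rw [intervalIntegral.integral_add hi1 hi2, prim_neg_one, zero_mul, sub_zero] at key
  rw [inner_eq_intervalIntegral _ _ (hV hφ) hγ, inner_eq_intervalIntegral _ _ hφ (hV hγ),
    ← inner_conj_symm f oneL2, inner_oneL2, inner_oneL2, prim_congr hφ one_mem_Icc,
    prim_congr hγ one_mem_Icc, ← prim_conj, ← key, add_comm]
  simp only [prim_conj]

theorem adjoint_volterra (f : UnitL2) :
    adjoint volterra f = inner ℂ oneL2 f • oneL2 - volterra f := by
  refine ext_inner_left ℂ fun g => ?_
  rw [adjoint_inner_right, inner_sub_right, inner_smul_right, eq_sub_iff_add_eq,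
    inner_volterra_add, mul_comm]

/-- The affine functions on `(-1, 1)`. -/
noncomputable def affineSubspace : Submodule ℂ UnitL2 :=
  Submodule.span ℂ {oneL2, volterra oneL2}

instance : FiniteDimensional ℂ affineSubspace :=
  FiniteDimensional.span_of_finite ℂ (by simp)

theorem mem_affineSubspace_iff {f : UnitL2} :
    f ∈ affineSubspace ↔ ∃ a b : ℂ, a • oneL2 + b • volterra oneL2 = f :=
  Submodule.mem_span_pair

/-- The orthogonal projection onto the affine functions. -/
noncomputable def affineProj : UnitL2 →L[ℂ] UnitL2 := affineSubspace.starProjection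

theorem affineProj_eq_self_iff {f : UnitL2} : affineProj f = f ↔ f ∈ affineSubspace :=
  Submodule.starProjection_eq_self_iff

/-- The adjoint formula trades orthogonality to `V1` for a condition on `Vf`. The two conditions say
that the first and second primitives vanish at `1`, which are the boundary conditions there. -/
theorem affineProj_eq_zero_iff {f : UnitL2} :
    affineProj f = 0 ↔ inner ℂ oneL2 f = 0 ∧ inner ℂ oneL2 (volterra f) = 0 := by
  rw [affineProj, Submodule.starProjection_apply_eq_zero_iff, affineSubspace,
    Submodule.mem_orthogonal]
  have h : ∀ f, inner ℂ (volterra oneL2) f =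
      inner ℂ oneL2 f * inner ℂ oneL2 oneL2 - inner ℂ oneL2 (volterra f) := by
    intro f
    rw [← adjoint_inner_right, adjoint_volterra, inner_sub_right, inner_smul_right]
  constructor
  · intro hf
    have h1 := hf oneL2 (Submodule.subset_span (by simp))
    have h2 := hf (volterra oneL2) (Submodule.subset_span (by simp))
    rw [h, h1, zero_mul, zero_sub, neg_eq_zero] at h2
    exact ⟨h1, h2⟩
  · rintro ⟨h1, h2⟩ u hu
    obtain ⟨a, b, rfl⟩ := Submodule.mem_span_pair.mp hu
    rw [inner_add_left, inner_smul_left, inner_smul_left, h, h1, h2]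
    simp

/-- Twofold integration of the part of a function orthogonal to the affine functions. -/
noncomputable def doubleVolterra : UnitL2 →L[ℂ] UnitL2 :=
  volterra ∘L volterra ∘L (1 - affineProj)

theorem doubleVolterra_apply (f : UnitL2) :
    doubleVolterra f = volterra (volterra (f - affineProj f)) := rfl

theorem affineProj_affineProj (f : UnitL2) : affineProj (affineProj f) = affineProj f :=
  affineProj_eq_self_iff.mpr (Submodule.starProjection_apply_mem _ _)

theorem isSelfAdjoint_affineProj : IsSelfAdjoint affineProj :=
  isSelfAdjoint_starProjection affineSubspace

/-- Orthogonality to the affine functions kills the rank-one term at each of the two steps, and the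
two signs cancel. -/
theorem adjoint_volterra_adjoint_volterra {f : UnitL2} (hf : affineProj f = 0) :
    adjoint volterra (adjoint volterra f) = volterra (volterra f) := by
  obtain ⟨h1, h2⟩ := affineProj_eq_zero_iff.mp hf
  rw [adjoint_volterra f, h1, zero_smul, zero_sub, map_neg, adjoint_volterra, h2, zero_smul,
    zero_sub, neg_neg]

theorem affineProj_sub (f : UnitL2) : affineProj (f - affineProj f) = 0 := by
  rw [map_sub, affineProj_affineProj, sub_self]

theorem adjoint_doubleVolterra (f : UnitL2) :
    adjoint doubleVolterra f = volterra (volterra f) - affineProj (volterra (volterra f)) := by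
  refine ext_inner_left ℂ fun g => ?_
  rw [adjoint_inner_right, doubleVolterra_apply,
    ← adjoint_volterra_adjoint_volterra (affineProj_sub g), adjoint_inner_left,
    adjoint_inner_left, inner_sub_left, inner_sub_right,
    inner_apply_of_isSelfAdjoint isSelfAdjoint_affineProj]

/-- Thus `K†K` is fourfold integration modulo affine functions, written as a manifestly nonnegative
operator. -/
theorem adjoint_doubleVolterra_doubleVolterra {f : UnitL2} (hf : affineProj f = 0) :
    adjoint doubleVolterra (doubleVolterra f) = volterra (volterra (volterra (volterra f))) -
      affineProj (volterra (volterra (volterra (volterra f)))) := by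
  rw [adjoint_doubleVolterra, doubleVolterra_apply, hf, sub_zero]

theorem isPencil_unit {M : UnitL2 →L[ℂ] UnitL2} (hM : IsSelfAdjoint M) :
    IsPencil affineProj doubleVolterra M where
  isSelfAdjoint_proj := isSelfAdjoint_affineProj
  proj_proj := affineProj_affineProj
  finiteDimensional := by
    rw [affineProj, Submodule.range_starProjection]
    infer_instance
  comp_proj x := by
    rw [doubleVolterra_apply, affineProj_affineProj, sub_self, map_zero, map_zero]
  isCompact := isCompactOperator_volterra.comp_clm (volterra ∘L (1 - affineProj))
  isSelfAdjoint := hM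

theorem eqOn_zero_of_ae_eq_zero {u : ℝ → ℂ} (hu : ContinuousOn u (Icc (-1) 1))
    (h : ∀ᵐ x ∂unitMeasure, u x = 0) : EqOn u (fun _ => 0) (Icc (-1) 1) := by
  have h1 : EqOn u (fun _ => 0) (Ioo (-1) 1) :=
    Measure.eqOn_open_of_ae_eq h isOpen_Ioo (hu.mono Ioo_subset_Icc_self) continuousOn_const
  exact h1.of_subset_closure hu continuousOn_const Ioo_subset_Icc_self
    (closure_Ioo (by norm_num)).symm.subset

theorem ae_eq_zero_of_prim_eq_zero {v : ℝ → ℂ} (hv : MemLp v 2 unitMeasure)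
    (h : ∀ x ∈ Icc (-1 : ℝ) 1, prim v x = 0) : ∀ᵐ x ∂unitMeasure, v x = 0 := by
  rw [ae_restrict_iff' measurableSet_Ioo]
  filter_upwards [(hv.intervalIntegrable_unit neg_one_mem_Icc
    one_mem_Icc).ae_hasDerivAt_integral] with x hx hxI
  have hx' : x ∈ uIcc (-1 : ℝ) 1 := by
    rw [uIcc_of_le (by norm_num)]
    exact Ioo_subset_Icc_self hxI
  have hd := hx hx' (-1) (by simp)
  have he : (fun y => ∫ ξ in (-1 : ℝ)..y, v ξ) =ᶠ[𝓝 x] fun _ => (0 : ℂ) := by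
    filter_upwards [Ioo_mem_nhds hxI.1 hxI.2] with y hy
    exact h y (Ioo_subset_Icc_self hy)
  exact (hd.congr_of_eventuallyEq he.symm).unique (hasDerivAt_const x (0 : ℂ))

theorem volterra_eq_zero {f : UnitL2} (hf : volterra f = 0) : f = 0 := by
  rw [Lp.eq_zero_iff_ae_eq_zero] at hf ⊢
  refine ae_eq_zero_of_prim_eq_zero (Lp.memLp f)
    (eqOn_zero_of_ae_eq_zero (continuousOn_prim (Lp.memLp f)) ?_)
  filter_upwards [hf, coeFn_volterra f] with x h1 h2
  rw [← h2, h1, Pi.zero_apply]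

theorem eq_zero_of_doubleVolterra {f : UnitL2} (h1 : affineProj f = 0)
    (h2 : doubleVolterra f = 0) : f = 0 := by
  rw [doubleVolterra_apply, h1, sub_zero] at h2
  exact volterra_eq_zero (volterra_eq_zero h2)

end Volterra

/-! ### Multiplication by the shape function -/

section Multiplication

open ContinuousLinearMap

namespace Shape

variable (Ψ : Shape)

theorem exists_bound : ∃ C : NNReal, ∀ x, |Ψ x| ≤ C := by
  have hc : HasCompactSupport Ψ := by
    rw [HasCompactSupport, Ψ.tsupport_eq]; exact isCompact_Icc
  obtain ⟨C, hC⟩ := hc.exists_bound_of_continuous Ψ.smooth.continuous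
  refine ⟨⟨max C 0, le_max_right _ _⟩, fun x => (hC x).trans (le_max_left _ _)⟩

theorem measurable_density : Measurable fun ξ => ENNReal.ofReal |Ψ ξ| :=
  (Ψ.smooth.continuous.abs.measurable).ennreal_ofReal

theorem weight_le {C : NNReal} (hC : ∀ x, |Ψ x| ≤ C) : Ψ.weight ≤ (C : ℝ≥0∞) • unitMeasure := by
  rw [weight, ← withDensity_const]
  refine withDensity_mono (Eventually.of_forall fun x => ?_)
  rw [← ENNReal.ofReal_coe_nnreal]
  exact ENNReal.ofReal_le_ofReal (hC x)

theorem memLp_weight {f : ℝ → ℂ} (hf : MemLp f 2 unitMeasure) : MemLp f 2 Ψ.weight := by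
  obtain ⟨C, hC⟩ := Ψ.exists_bound
  exact hf.of_measure_le_smul ENNReal.coe_ne_top (Ψ.weight_le hC)

theorem eLpNorm_weight_le {C : NNReal} (hC : ∀ x, |Ψ x| ≤ C) (f : ℝ → ℂ) :
    eLpNorm f 2 Ψ.weight ≤ (C : ℝ≥0∞) ^ (1 / 2 : ℝ) * eLpNorm f 2 unitMeasure := by
  refine (eLpNorm_mono_measure f (Ψ.weight_le hC)).trans (le_of_eq ?_)
  rw [eLpNorm_smul_measure_of_ne_top (by norm_num)]
  simp

theorem ae_weight_of_ae_unit {p : ℝ → Prop} (h : ∀ᵐ x ∂unitMeasure, p x) :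
    ∀ᵐ x ∂Ψ.weight, p x :=
  Ψ.ae_weight_of_ae (h.mono fun _ hx _ => hx)

/-- The natural map of `L²(-1, 1)` into the weighted space. -/
noncomputable def embed : UnitL2 →L[ℂ] Ψ.Space :=
  LinearMap.mkContinuous
    { toFun := fun f => MemLp.toLp f (Ψ.memLp_weight (Lp.memLp f))
      map_add' := by
        intro f g
        rw [← MemLp.toLp_add, MemLp.toLp_eq_toLp_iff]
        exact Ψ.ae_weight_of_ae_unit (Lp.coeFn_add f g)
      map_smul' := by
        intro c f
        rw [RingHom.id_apply, ← MemLp.toLp_const_smul, MemLp.toLp_eq_toLp_iff]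
        exact Ψ.ae_weight_of_ae_unit (Lp.coeFn_smul c f) }
    ((Ψ.exists_bound.choose : ℝ≥0∞) ^ (1 / 2 : ℝ)).toReal (by
      intro f
      rw [LinearMap.coe_mk, AddHom.coe_mk, Lp.norm_toLp, Lp.norm_def, ← ENNReal.toReal_mul]
      exact ENNReal.toReal_mono
        (ENNReal.mul_ne_top (ENNReal.rpow_ne_top_of_nonneg (by norm_num) ENNReal.coe_ne_top)
          (Lp.memLp f).2.ne)
        (Ψ.eLpNorm_weight_le Ψ.exists_bound.choose_spec f))

theorem coeFn_embed (f : UnitL2) : Ψ.embed f =ᵐ[Ψ.weight] f :=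
  MemLp.coeFn_toLp (Ψ.memLp_weight (Lp.memLp f))

/-- Pointwise `|Ψg|² ≤ C|g|²|Ψ|`: one factor `|Ψ|` is bounded, the other becomes the weight. -/
theorem eLpNorm_mul_le {C : NNReal} (hC : ∀ x, |Ψ x| ≤ C) {g : ℝ → ℂ} (hg : Measurable g) :
    eLpNorm (fun x => (Ψ x : ℂ) * g x) 2 unitMeasure ≤
      (C : ℝ≥0∞) ^ (1 / 2 : ℝ) * eLpNorm g 2 Ψ.weight := by
  rw [eLpNorm_eq_lintegral_rpow_enorm_toReal (by norm_num) (by norm_num),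
    eLpNorm_eq_lintegral_rpow_enorm_toReal (by norm_num) (by norm_num), ENNReal.toReal_ofNat,
    ← ENNReal.mul_rpow_of_nonneg _ _ (by norm_num : (0 : ℝ) ≤ 1 / 2), weight,
    lintegral_withDensity_eq_lintegral_mul _ Ψ.measurable_density (by fun_prop),
    ← lintegral_const_mul _ (Ψ.measurable_density.mul (by fun_prop))]
  refine ENNReal.rpow_le_rpow (lintegral_mono fun x => ?_) (by norm_num)
  simp only [Pi.mul_apply]
  rw [enorm_mul, ENNReal.mul_rpow_of_nonneg _ _ (by norm_num), ← mul_assoc]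
  gcongr
  have h1 : ‖(Ψ x : ℂ)‖ₑ = ENNReal.ofReal |Ψ x| := by
    rw [← ofReal_norm, Complex.norm_real, Real.norm_eq_abs]
  rw [h1, ENNReal.rpow_two, sq]
  gcongr
  rw [← ENNReal.ofReal_coe_nnreal]
  exact ENNReal.ofReal_le_ofReal (hC x)

theorem memLp_mul (g : Ψ.Space) : MemLp (fun x => (Ψ x : ℂ) * g x) 2 unitMeasure := by
  obtain ⟨C, hC⟩ := Ψ.exists_bound
  have hg := (Lp.stronglyMeasurable g).measurable
  refine ⟨((Complex.measurable_ofReal.comp Ψ.smooth.continuous.measurable).mul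
    hg).aestronglyMeasurable, (Ψ.eLpNorm_mul_le hC hg).trans_lt ?_⟩
  exact ENNReal.mul_lt_top (ENNReal.rpow_lt_top_of_nonneg (by norm_num) ENNReal.coe_ne_top)
    (Lp.memLp g).2

theorem ae_mul_congr {f g : ℝ → ℂ} (h : f =ᵐ[Ψ.weight] g) :
    (fun x => (Ψ x : ℂ) * f x) =ᵐ[unitMeasure] fun x => (Ψ x : ℂ) * g x := by
  filter_upwards [Ψ.ae_of_ae_weight h] with x hx
  by_cases h0 : Ψ x = 0
  · simp [h0]
  · rw [hx h0]

/-- Multiplication by `Ψ`, from the weighted space to `L²(-1, 1)`. -/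
noncomputable def mulToUnit : Ψ.Space →L[ℂ] UnitL2 :=
  LinearMap.mkContinuous
    { toFun := fun g => MemLp.toLp _ (Ψ.memLp_mul g)
      map_add' := by
        intro f g
        rw [← MemLp.toLp_add, MemLp.toLp_eq_toLp_iff]
        refine (Ψ.ae_mul_congr (Lp.coeFn_add f g)).trans (Eventually.of_forall fun x => ?_)
        simp only [Pi.add_apply, mul_add]
      map_smul' := by
        intro c g
        rw [RingHom.id_apply, ← MemLp.toLp_const_smul, MemLp.toLp_eq_toLp_iff]
        refine (Ψ.ae_mul_congr (Lp.coeFn_smul c g)).trans (Eventually.of_forall fun x => ?_)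
        simp only [Pi.smul_apply, smul_eq_mul]
        ring }
    ((Ψ.exists_bound.choose : ℝ≥0∞) ^ (1 / 2 : ℝ)).toReal (by
      intro g
      rw [LinearMap.coe_mk, AddHom.coe_mk, Lp.norm_toLp, Lp.norm_def, ← ENNReal.toReal_mul]
      exact ENNReal.toReal_mono
        (ENNReal.mul_ne_top (ENNReal.rpow_ne_top_of_nonneg (by norm_num) ENNReal.coe_ne_top)
          (Lp.memLp g).2.ne)
        (Ψ.eLpNorm_mul_le Ψ.exists_bound.choose_spec (Lp.stronglyMeasurable g).measurable))

theorem coeFn_mulToUnit (g : Ψ.Space) :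
    Ψ.mulToUnit g =ᵐ[unitMeasure] fun x => (Ψ x : ℂ) * g x :=
  MemLp.coeFn_toLp (Ψ.memLp_mul g)

theorem mulToUnit_eq_zero {g : Ψ.Space} (h : Ψ.mulToUnit g = 0) : g = 0 := by
  rw [Lp.eq_zero_iff_ae_eq_zero] at h ⊢
  refine Ψ.ae_weight_of_ae ?_
  filter_upwards [h, Ψ.coeFn_mulToUnit g] with x h1 h2 hne
  rw [h1, Pi.zero_apply] at h2
  have hne' : (Ψ x : ℂ) ≠ 0 := by exact_mod_cast hne
  simpa [hne'] using h2.symm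

/-- Multiplication by `Ψ` in `L²(-1, 1)`. -/
noncomputable def mulUnit : UnitL2 →L[ℂ] UnitL2 := Ψ.mulToUnit ∘L Ψ.embed

theorem coeFn_mulUnit (f : UnitL2) : Ψ.mulUnit f =ᵐ[unitMeasure] fun x => (Ψ x : ℂ) * f x :=
  (Ψ.coeFn_mulToUnit _).trans (Ψ.ae_mul_congr (Ψ.coeFn_embed f))

theorem isSelfAdjoint_mulUnit : IsSelfAdjoint Ψ.mulUnit := by
  rw [isSelfAdjoint_iff_isSymmetric]
  intro f g
  rw [ContinuousLinearMap.coe_coe, L2.inner_def, L2.inner_def]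
  refine integral_congr_ae ?_
  filter_upwards [Ψ.coeFn_mulUnit f, Ψ.coeFn_mulUnit g] with x h1 h2
  rw [h1, h2]
  simp only [RCLike.inner_apply, map_mul, Complex.conj_ofReal]
  ring

/-- A continuous function on `[-1, 1]` that vanishes almost everywhere for the weight vanishes
identically. -/
theorem eqOn_zero_of_ae_weight {u : ℝ → ℂ} (hu : ContinuousOn u (Icc (-1) 1))
    (h : ∀ᵐ x ∂Ψ.weight, u x = 0) : EqOn u (fun _ => 0) (Icc (-1) 1) := by
  have hopen : IsOpen (Function.support Ψ) := Ψ.smooth.continuous.isOpen_support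
  -- Zeros of `Ψ` may have positive measure, but the set where `Ψ ≠ 0` is open and dense, which
  -- suffices for continuous functions.
  have hcl : closure (Function.support Ψ) = Icc (-1 : ℝ) 1 := Ψ.tsupport_eq
  have hsub : Function.support Ψ ⊆ Icc (-1 : ℝ) 1 := hcl ▸ subset_closure
  have hsub' : Function.support Ψ ⊆ Ioo (-1 : ℝ) 1 := by
    rw [← interior_Icc]
    exact interior_maximal hsub hopen
  have h1 : u =ᵐ[volume.restrict (Function.support Ψ)] (fun _ => 0) := by
    have h3 := ae_mono (Measure.restrict_mono hsub' le_rfl) (Ψ.ae_of_ae_weight h)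
    filter_upwards [h3, ae_restrict_mem hopen.measurableSet] with ξ h₁ h₂
    exact h₁ h₂
  exact (Measure.eqOn_open_of_ae_eq h1 hopen (hu.mono hsub)
    continuousOn_const).of_subset_closure hu continuousOn_const hsub hcl.symm.subset

/-- `Ψ.embed` need not be injective on all of `L²(-1, 1)`; continuity of a representative restores
injectivity. -/
theorem eq_zero_of_embed_eq_zero {U : UnitL2} {u : ℝ → ℂ} (hu : ContinuousOn u (Icc (-1) 1))
    (hU : U =ᵐ[unitMeasure] u) (h : Ψ.embed U = 0) : U = 0 := by
  rw [Lp.eq_zero_iff_ae_eq_zero] at h ⊢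
  have h1 : EqOn u (fun _ => 0) (Icc (-1) 1) := by
    refine Ψ.eqOn_zero_of_ae_weight hu ?_
    filter_upwards [h, Ψ.coeFn_embed U, Ψ.ae_weight_of_ae_unit hU] with x h1 h2 h3
    rw [← h3, ← h2, h1, Pi.zero_apply]
  filter_upwards [hU, ae_restrict_mem measurableSet_Ioo] with x h2 hx
  rw [h2, h1 (Ioo_subset_Icc_self hx), Pi.zero_apply]

end Shape

theorem exists_affine_rep {U : UnitL2} (hU : U ∈ affineSubspace) :
    ∃ a b : ℂ, U =ᵐ[unitMeasure] fun x => a + b * (x + 1) := by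
  obtain ⟨a, b, rfl⟩ := mem_affineSubspace_iff.mp hU
  refine ⟨a, b, ?_⟩
  filter_upwards [Lp.coeFn_add (a • oneL2) (b • volterra oneL2), Lp.coeFn_smul a oneL2,
    Lp.coeFn_smul b (volterra oneL2), coeFn_oneL2, coeFn_volterra oneL2,
    ae_restrict_mem measurableSet_Ioo] with x h1 h2 h3 h4 h5 hx
  rw [h1, Pi.add_apply, h2, h3, Pi.smul_apply, Pi.smul_apply, h4, h5,
    prim_congr coeFn_oneL2 (Ioo_subset_Icc_self hx)]
  simp [prim]

namespace Shape

variable (Ψ : Shape)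

theorem eq_zero_of_mem_affineSubspace {U : UnitL2} (hU : U ∈ affineSubspace)
    (h : Ψ.embed U = 0) : U = 0 := by
  obtain ⟨a, b, hab⟩ := exists_affine_rep hU
  exact Ψ.eq_zero_of_embed_eq_zero (by fun_prop) hab h

theorem isPencil : IsPencil affineProj doubleVolterra Ψ.mulUnit :=
  isPencil_unit Ψ.isSelfAdjoint_mulUnit

theorem eq_zero_of_mulUnit {U : UnitL2} (h1 : affineProj U = U) (h2 : Ψ.mulUnit U = 0) : U = 0 :=
  Ψ.eq_zero_of_mem_affineSubspace (affineProj_eq_self_iff.mp h1) (Ψ.mulToUnit_eq_zero h2)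

end Shape

end Multiplication

/-! ### The operator in terms of the Volterra operator -/

section Lift

open ContinuousLinearMap

theorem iteratedDerivWithin_succ_of_hasDerivWithinAt {u u' : ℝ → ℂ}
    (h : ∀ x ∈ Icc (-1 : ℝ) 1, HasDerivWithinAt u (u' x) (Icc (-1) 1) x) (n : ℕ) {x : ℝ}
    (hx : x ∈ Icc (-1 : ℝ) 1) :
    iteratedDerivWithin (n + 1) u (Icc (-1) 1) x = iteratedDerivWithin n u' (Icc (-1) 1) x := by
  rw [iteratedDerivWithin_succ']
  exact iteratedDerivWithin_congr
    (fun y hy => (h y hy).derivWithin (uniqueDiffOn_Icc_neg_one_one y hy)) hx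

theorem contDiffOn_succ_of_hasDerivWithinAt {u u' : ℝ → ℂ}
    (h : ∀ x ∈ Icc (-1 : ℝ) 1, HasDerivWithinAt u (u' x) (Icc (-1) 1) x) {n : ℕ}
    (hu' : ContDiffOn ℝ n u' (Icc (-1) 1)) : ContDiffOn ℝ (n + 1 : ℕ) u (Icc (-1) 1) := by
  rw [Nat.cast_add, Nat.cast_one, contDiffOn_succ_iff_derivWithin uniqueDiffOn_Icc_neg_one_one]
  refine ⟨fun x hx => (h x hx).differentiableWithinAt, by simp, hu'.congr fun y hy => ?_⟩
  exact (h y hy).derivWithin (uniqueDiffOn_Icc_neg_one_one y hy)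

theorem prim_congr_Icc {f g : ℝ → ℂ} (h : EqOn f g (Icc (-1) 1)) {x : ℝ}
    (hx : x ∈ Icc (-1 : ℝ) 1) : prim f x = prim g x := by
  refine prim_congr ?_ hx
  filter_upwards [ae_restrict_mem measurableSet_Ioo] with y hy
  exact h (Ioo_subset_Icc_self hy)

theorem eq_add_prim {u u' : ℝ → ℂ} (hu' : ContinuousOn u' (Icc (-1) 1))
    (h : ∀ x ∈ Icc (-1 : ℝ) 1, HasDerivWithinAt u (u' x) (Icc (-1) 1) x) {x : ℝ}
    (hx : x ∈ Icc (-1 : ℝ) 1) : u x = u (-1) + prim u' x := by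
  rw [prim, intervalIntegral.integral_eq_sub_of_hasDerivAt_of_le hx.1 (f := u)]
  · ring
  · exact fun y hy => (h y ⟨hy.1, hy.2.trans hx.2⟩).continuousWithinAt.mono
      (Icc_subset_Icc_right hx.2)
  · intro y hy
    have hyI : y ∈ Ioo (-1 : ℝ) 1 := ⟨hy.1, hy.2.trans_le hx.2⟩
    exact (h y (Ioo_subset_Icc_self hyI)).hasDerivAt (Icc_mem_nhds hyI.1 hyI.2)
  · exact (memLp_of_continuousOn hu').intervalIntegrable_unit neg_one_mem_Icc hx

/-- The function with fourth derivative `v`, second and third derivatives vanishing at `-1`, and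
values `a`, `b` of the function and its derivative at `-1`. -/
noncomputable def fourfoldPrim (a b : ℂ) (v : ℝ → ℂ) (x : ℝ) : ℂ :=
  a + b * (x + 1) + prim (prim (prim (prim v))) x

section FourfoldPrim

variable {v : ℝ → ℂ} (hv : MemLp v 2 unitMeasure) (a b : ℂ)
include hv

theorem continuousOn_prim_prim : ContinuousOn (prim (prim v)) (Icc (-1) 1) :=
  continuousOn_prim (memLp_of_continuousOn (continuousOn_prim hv))

theorem continuousOn_prim_prim_prim : ContinuousOn (prim (prim (prim v))) (Icc (-1) 1) :=
  continuousOn_prim (memLp_of_continuousOn (continuousOn_prim_prim hv))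

theorem hasDerivWithinAt_fourfoldPrim {x : ℝ} (hx : x ∈ Icc (-1 : ℝ) 1) :
    HasDerivWithinAt (fourfoldPrim a b v) (b + prim (prim (prim v)) x) (Icc (-1) 1) x := by
  have h1 := hasDerivWithinAt_prim (continuousOn_prim_prim_prim hv) hx
  have h2 : HasDerivAt (fun x : ℝ => a + b * ((x : ℂ) + 1)) b x := by
    have := (((hasDerivAt_id x).ofReal_comp.add_const (1 : ℂ)).const_mul b).const_add a
    simpa using this
  exact h2.hasDerivWithinAt.add h1

theorem hasDerivWithinAt_fourfoldPrim_one {x : ℝ} (hx : x ∈ Icc (-1 : ℝ) 1) :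
    HasDerivWithinAt (fun x => b + prim (prim (prim v)) x) (prim (prim v) x) (Icc (-1) 1) x :=
  (hasDerivWithinAt_prim (continuousOn_prim_prim hv) hx).const_add b

theorem iteratedDerivWithin_two_fourfoldPrim {x : ℝ} (hx : x ∈ Icc (-1 : ℝ) 1) :
    iteratedDerivWithin 2 (fourfoldPrim a b v) (Icc (-1) 1) x = prim (prim v) x := by
  rw [iteratedDerivWithin_succ_of_hasDerivWithinAt
      (fun x hx => hasDerivWithinAt_fourfoldPrim hv a b hx) 1 hx,
    iteratedDerivWithin_succ_of_hasDerivWithinAt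
      (fun x hx => hasDerivWithinAt_fourfoldPrim_one hv b hx) 0 hx, iteratedDerivWithin_zero]

theorem iteratedDerivWithin_three_fourfoldPrim {x : ℝ} (hx : x ∈ Icc (-1 : ℝ) 1) :
    iteratedDerivWithin 3 (fourfoldPrim a b v) (Icc (-1) 1) x = prim v x := by
  rw [iteratedDerivWithin_succ_of_hasDerivWithinAt
      (fun x hx => hasDerivWithinAt_fourfoldPrim hv a b hx) 2 hx,
    iteratedDerivWithin_succ_of_hasDerivWithinAt
      (fun x hx => hasDerivWithinAt_fourfoldPrim_one hv b hx) 1 hx,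
    iteratedDerivWithin_succ_of_hasDerivWithinAt
      (fun x hx => hasDerivWithinAt_prim (continuousOn_prim hv) hx) 0 hx, iteratedDerivWithin_zero]

theorem isW42_fourfoldPrim : IsW42 (fourfoldPrim a b v) v where
  contDiffOn := by
    have h0 : ContDiffOn ℝ (0 : ℕ) (prim v) (Icc (-1) 1) :=
      contDiffOn_zero.mpr (continuousOn_prim hv)
    have h1 := contDiffOn_succ_of_hasDerivWithinAt
      (fun x hx => hasDerivWithinAt_prim (continuousOn_prim hv) hx) h0
    have h2 := contDiffOn_succ_of_hasDerivWithinAt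
      (fun x hx => hasDerivWithinAt_fourfoldPrim_one hv b hx) h1
    exact contDiffOn_succ_of_hasDerivWithinAt
      (fun x hx => hasDerivWithinAt_fourfoldPrim hv a b hx) h2
  memLp := hv
  eq_integral x hx := by
    rw [iteratedDerivWithin_three_fourfoldPrim hv a b hx,
      iteratedDerivWithin_three_fourfoldPrim hv a b neg_one_mem_Icc, prim_neg_one, zero_add]
    rfl

/-- The conditions at `-1` are built into the primitives; only those at `1` restrict `v`. -/
theorem neumannBC_fourfoldPrim_iff :
    NeumannBC (fourfoldPrim a b v) ↔ prim v 1 = 0 ∧ prim (prim v) 1 = 0 := by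
  rw [NeumannBC, iteratedDerivWithin_two_fourfoldPrim hv a b neg_one_mem_Icc,
    iteratedDerivWithin_two_fourfoldPrim hv a b one_mem_Icc,
    iteratedDerivWithin_three_fourfoldPrim hv a b neg_one_mem_Icc,
    iteratedDerivWithin_three_fourfoldPrim hv a b one_mem_Icc, prim_neg_one, prim_neg_one]
  tauto

end FourfoldPrim

theorem IsW42.hasDerivWithinAt {u v : ℝ → ℂ} (h : IsW42 u v) {n : ℕ} (hn : n < 3) {x : ℝ}
    (hx : x ∈ Icc (-1 : ℝ) 1) : HasDerivWithinAt (iteratedDerivWithin n u (Icc (-1) 1))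
      (iteratedDerivWithin (n + 1) u (Icc (-1) 1) x) (Icc (-1) 1) x := by
  rw [iteratedDerivWithin_succ]
  exact (h.contDiffOn.differentiableOn_iteratedDerivWithin (by exact_mod_cast hn)
    uniqueDiffOn_Icc_neg_one_one x hx).hasDerivWithinAt

theorem IsW42.continuousOn {u v : ℝ → ℂ} (h : IsW42 u v) {n : ℕ} (hn : n ≤ 3) :
    ContinuousOn (iteratedDerivWithin n u (Icc (-1) 1)) (Icc (-1) 1) :=
  h.contDiffOn.continuousOn_iteratedDerivWithin (by exact_mod_cast hn) uniqueDiffOn_Icc_neg_one_one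

/-- Integrating down from the third derivative, the conditions at `-1` remove two constants; the
other two are `u(-1)` and `u'(-1)`. -/
theorem IsW42.eqOn_fourfoldPrim {u v : ℝ → ℂ} (h : IsW42 u v) (hb : NeumannBC u) :
    ∃ a b : ℂ, EqOn u (fourfoldPrim a b v) (Icc (-1) 1) := by
  obtain ⟨hb1, -, hb2, -⟩ := hb
  have h3 : EqOn (iteratedDerivWithin 3 u (Icc (-1) 1)) (prim v) (Icc (-1) 1) := by
    intro x hx
    rw [h.eq_integral x hx, hb2, zero_add]; rfl
  have h2 : EqOn (iteratedDerivWithin 2 u (Icc (-1) 1)) (prim (prim v)) (Icc (-1) 1) := by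
    intro x hx
    rw [eq_add_prim (h.continuousOn le_rfl)
      (fun y hy => h.hasDerivWithinAt (n := 2) (by norm_num) hy) hx, hb1, zero_add,
      prim_congr_Icc h3 hx]
  let b := iteratedDerivWithin 1 u (Icc (-1) 1) (-1)
  have h1 : EqOn (iteratedDerivWithin 1 u (Icc (-1) 1)) (fun x => b + prim (prim (prim v)) x)
      (Icc (-1) 1) := by
    intro x hx
    rw [eq_add_prim (h.continuousOn (n := 2) (by norm_num))
      (fun y hy => h.hasDerivWithinAt (n := 1) (by norm_num) hy) hx, prim_congr_Icc h2 hx]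
  refine ⟨u (-1), b, fun x hx => ?_⟩
  have h0 := eq_add_prim (u := iteratedDerivWithin 0 u (Icc (-1) 1))
    (h.continuousOn (n := 1) (by norm_num))
    (fun y hy => h.hasDerivWithinAt (n := 0) (by norm_num) hy) hx
  rw [iteratedDerivWithin_zero, prim_congr_Icc h1 hx] at h0
  have h4 := eq_add_prim ((continuousOn_const (c := b)).add (continuousOn_prim_prim_prim h.memLp))
    (fun y hy => hasDerivWithinAt_fourfoldPrim h.memLp (u (-1)) b hy) hx
  rw [h0, h4, fourfoldPrim, prim_neg_one]
  simp only [Complex.ofReal_neg, Complex.ofReal_one, neg_add_cancel, mul_zero, add_zero]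
  rfl

theorem coeFn_volterra_of_ae_eq {f : UnitL2} {χ : ℝ → ℂ} (h : f =ᵐ[unitMeasure] χ) :
    volterra f =ᵐ[unitMeasure] prim χ := by
  filter_upwards [coeFn_volterra f, ae_restrict_mem measurableSet_Ioo] with x hx hxI
  rw [hx, prim_congr h (Ioo_subset_Icc_self hxI)]

theorem coeFn_fourfold {F : UnitL2} {v : ℝ → ℂ} (h : F =ᵐ[unitMeasure] v) (a b : ℂ) :
    (a • oneL2 + b • volterra oneL2 + volterra (volterra (volterra (volterra F))) : UnitL2)
      =ᵐ[unitMeasure] fourfoldPrim a b v := by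
  filter_upwards [Lp.coeFn_add (a • oneL2 + b • volterra oneL2)
      (volterra (volterra (volterra (volterra F)))),
    Lp.coeFn_add (a • oneL2) (b • volterra oneL2), Lp.coeFn_smul a oneL2,
    Lp.coeFn_smul b (volterra oneL2), coeFn_oneL2, coeFn_volterra_of_ae_eq coeFn_oneL2,
    coeFn_volterra_of_ae_eq (coeFn_volterra_of_ae_eq (coeFn_volterra_of_ae_eq
      (coeFn_volterra_of_ae_eq h)))] with x h0 h1 h2 h3 h4 h5 h6
  rw [h0, Pi.add_apply, h1, Pi.add_apply, h2, h3, Pi.smul_apply, Pi.smul_apply, h4, h5, h6]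
  simp [prim, fourfoldPrim]

theorem affineProj_eq_zero_iff_prim {F : UnitL2} {v : ℝ → ℂ} (h : F =ᵐ[unitMeasure] v) :
    affineProj F = 0 ↔ prim v 1 = 0 ∧ prim (prim v) 1 = 0 := by
  rw [affineProj_eq_zero_iff, inner_oneL2, inner_oneL2, prim_congr h one_mem_Icc,
    prim_congr (coeFn_volterra_of_ae_eq h) one_mem_Icc]

namespace Shape

variable (Ψ : Shape)

/-- `U ∈ L²(-1, 1)` lies in `W₂⁴(-1, 1)`, satisfies the boundary conditions, and `U⁗ = Ψ g`. -/
def Lift (U : UnitL2) (g : Ψ.Space) : Prop :=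
  affineProj (Ψ.mulToUnit g) = 0 ∧
    U - affineProj U = adjoint doubleVolterra (doubleVolterra (Ψ.mulToUnit g))

theorem lift_iff {U : UnitL2} {g : Ψ.Space} :
    Ψ.Lift U g ↔ affineProj (Ψ.mulToUnit g) = 0 ∧ ∃ a b : ℂ, U =
      a • oneL2 + b • volterra oneL2 +
        volterra (volterra (volterra (volterra (Ψ.mulToUnit g)))) := by
  refine and_congr_right fun h => ?_
  rw [adjoint_doubleVolterra_doubleVolterra h]
  set Y := volterra (volterra (volterra (volterra (Ψ.mulToUnit g))))
  constructor
  · intro hU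
    have h1 : U - Y ∈ affineSubspace := by
      rw [← affineProj_eq_self_iff, map_sub]
      rw [sub_eq_iff_eq_add] at hU
      nth_rewrite 2 [hU]
      abel
    obtain ⟨a, b, hab⟩ := mem_affineSubspace_iff.mp h1
    exact ⟨a, b, by rw [hab]; abel⟩
  · rintro ⟨a, b, rfl⟩
    rw [map_add, affineProj_eq_self_iff.mpr (mem_affineSubspace_iff.mpr ⟨a, b, rfl⟩)]
    abel

/-- Passing to an unweighted class `U` replaces derivatives and boundary values by the bounded
operators `P` and `K`. -/
theorem rel_iff {f g : Ψ.Space} : Ψ.Rel f g ↔ ∃ U, Ψ.embed U = f ∧ Ψ.Lift U g := by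
  constructor
  · rintro ⟨u, v, hw, hb, hf, hg⟩
    have hvF : Ψ.mulToUnit g =ᵐ[unitMeasure] v := (Ψ.coeFn_mulToUnit g).trans (EventuallyEq.symm hg)
    obtain ⟨a, b, hab⟩ := hw.eqOn_fourfoldPrim hb
    have hb' : NeumannBC (fourfoldPrim a b v) := by
      obtain ⟨c1, c2, c3, c4⟩ := hb
      refine ⟨?_, ?_, ?_, ?_⟩
      · rw [← iteratedDerivWithin_congr hab neg_one_mem_Icc, c1]
      · rw [← iteratedDerivWithin_congr hab one_mem_Icc, c2]
      · rw [← iteratedDerivWithin_congr hab neg_one_mem_Icc, c3]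
      · rw [← iteratedDerivWithin_congr hab one_mem_Icc, c4]
    refine ⟨_, ?_, Ψ.lift_iff.mpr ⟨(affineProj_eq_zero_iff_prim hvF).mpr
      ((neumannBC_fourfoldPrim_iff hw.memLp a b).mp hb'), a, b, rfl⟩⟩
    refine Lp.ext ?_
    have hI : ∀ᵐ x ∂Ψ.weight, x ∈ Ioo (-1 : ℝ) 1 :=
      Ψ.ae_weight_of_ae_unit (ae_restrict_mem measurableSet_Ioo)
    filter_upwards [Ψ.coeFn_embed _, Ψ.ae_weight_of_ae_unit (coeFn_fourfold hvF a b), hf, hI]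
      with x h1 h2 h3 h4
    rw [h1, h2, h3, hab (Ioo_subset_Icc_self h4)]
  · rintro ⟨U, rfl, hU⟩
    obtain ⟨h1, a, b, rfl⟩ := Ψ.lift_iff.mp hU
    have hF := Ψ.coeFn_mulToUnit g
    refine ⟨fourfoldPrim a b fun x => (Ψ x : ℂ) * g x, fun x => (Ψ x : ℂ) * g x,
      isW42_fourfoldPrim (Ψ.memLp_mul g) a b,
      (neumannBC_fourfoldPrim_iff (Ψ.memLp_mul g) a b).mpr
        ((affineProj_eq_zero_iff_prim hF).mp h1), ?_, Eventually.of_forall fun _ => rfl⟩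
    filter_upwards [Ψ.coeFn_embed _, Ψ.ae_weight_of_ae_unit (coeFn_fourfold hF a b)] with x h2 h3
    rw [h2, h3]

end Shape

end Lift

/-! ### The spectrum of the operator -/

section IteratedKer

variable {H : Type*} [NormedAddCommGroup H] [NormedSpace ℂ H] {T : H →ₗ.[ℂ] H} {z : ℂ}

theorem IsUnboundedEigenvalue.mem_unboundedSpectrum (h : IsUnboundedEigenvalue T z) :
    z ∈ unboundedSpectrum T := by
  rintro ⟨R, -, hR⟩
  obtain ⟨u, hu, hTu⟩ := h
  have := hR u
  rw [hTu, sub_self, map_zero] at this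
  exact hu this.symm

theorem mem_iteratedKer_succ {n : ℕ} {v : H} :
    v ∈ iteratedKer T z (n + 1) ↔ ∃ u : T.domain, (u : H) = v ∧ T u - z • v ∈ iteratedKer T z n := by
  rw [iteratedKer, Submodule.mem_map]
  constructor
  · rintro ⟨u, hu, rfl⟩
    exact ⟨u, rfl, hu⟩
  · rintro ⟨u, rfl, hu⟩
    exact ⟨u, hu, rfl⟩

theorem iteratedKer_le_of_succ_le {n : ℕ} (h : iteratedKer T z (n + 1) ≤ iteratedKer T z n) (k : ℕ) :
    iteratedKer T z (n + k) ≤ iteratedKer T z n := by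
  induction k with
  | zero => exact le_rfl
  | succ k ih =>
    refine le_trans (fun v hv => ?_) h
    obtain ⟨u, rfl, hu⟩ := mem_iteratedKer_succ.mp hv
    exact mem_iteratedKer_succ.mpr ⟨u, rfl, ih hu⟩

theorem iteratedKer_le_succ (n : ℕ) : iteratedKer T z n ≤ iteratedKer T z (n + 1) := by
  induction n with
  | zero => exact bot_le
  | succ n ih =>
    intro v hv
    obtain ⟨u, rfl, hu⟩ := mem_iteratedKer_succ.mp hv
    exact mem_iteratedKer_succ.mpr ⟨u, rfl, ih hu⟩

theorem rootSubspace_le_of_succ_le {n : ℕ} (h : iteratedKer T z (n + 1) ≤ iteratedKer T z n) :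
    rootSubspace T z ≤ iteratedKer T z n :=
  iSup_le fun k => (monotone_nat_of_le_succ iteratedKer_le_succ (Nat.le_add_left k n)).trans
    (iteratedKer_le_of_succ_le h k)

/-- `T - z` maps each level into the preceding one, with kernel the first level. -/
theorem finiteDimensional_iteratedKer (h : FiniteDimensional ℂ (iteratedKer T z 1)) (n : ℕ) :
    FiniteDimensional ℂ (iteratedKer T z n) := by
  induction n with
  | zero => exact inferInstanceAs (FiniteDimensional ℂ (⊥ : Submodule ℂ H))
  | succ n ih =>
    refine Module.Finite.iff_fg.mpr (Submodule.FG.map _ (Submodule.fg_of_fg_map_of_fg_inf_ker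
      (T.toFun - z • T.domain.subtype) ?_ ?_))
    · exact Module.Finite.iff_fg.mp (Submodule.finiteDimensional_of_le (Submodule.map_comap_le _ _))
    · refine Submodule.fg_of_fg_map_injective T.domain.subtype (Submodule.injective_subtype _)
        (Module.Finite.iff_fg.mp (Submodule.finiteDimensional_of_le (S₂ := iteratedKer T z 1) ?_))
      exact Submodule.map_mono inf_le_right

end IteratedKer

/-! ### Spectrum, pencil and root subspaces of `T_Ψ` -/

namespace Shape

open ContinuousLinearMap Module.End

variable (Ψ : Shape)

theorem rel_apply (u : Ψ.operator.domain) : Ψ.Rel u (Ψ.operator u) := by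
  rw [← Ψ.mem_graph_operator]
  exact Ψ.operator.mem_graph u

theorem rel_iff_exists {f g : Ψ.Space} :
    Ψ.Rel f g ↔ ∃ u : Ψ.operator.domain, (u : Ψ.Space) = f ∧ Ψ.operator u = g := by
  rw [← Ψ.mem_graph_operator, LinearPMap.mem_graph_iff]

/-- The two conditions of `Lift` lie in the range of `P` and in its complement, so their combination
loses nothing and `P` recovers each. This holds at `z = 0` too, since `P` also acts on the
right-hand side. -/
theorem lift_iff_pencil {U : UnitL2} {g : Ψ.Space} {z : ℂ} :
    Ψ.Lift U (z • Ψ.embed U + g) ↔ U - pencil affineProj doubleVolterra Ψ.mulUnit z U =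
      affineProj (Ψ.mulToUnit g) +
        adjoint doubleVolterra (doubleVolterra (Ψ.mulToUnit g)) := by
  have hM : Ψ.mulToUnit (Ψ.embed U) = Ψ.mulUnit U := rfl
  rw [Lift, pencil_apply, map_add, map_smul, hM]
  constructor
  · rintro ⟨h1, h2⟩
    simp only [map_add, map_smul] at h1 h2
    linear_combination (norm := module) h2 - h1
  · intro h
    have h1 := congrArg affineProj h
    simp only [map_add, map_sub, map_smul, Ψ.isPencil.proj_adjoint, affineProj_affineProj] at h1
    simp only [map_add, map_smul]
    constructor
    · linear_combination (norm := module) -h1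
    · linear_combination (norm := module) h - h1

theorem mem_pencilSpectrum_iff {z : ℂ} :
    z ∈ pencilSpectrum affineProj doubleVolterra Ψ.mulUnit ↔
      ∃ U, U ≠ 0 ∧ Ψ.Lift U (z • Ψ.embed U) := by
  refine exists_congr fun U => and_congr_right fun _ => ?_
  have := Ψ.lift_iff_pencil (U := U) (g := 0) (z := z)
  simp only [map_zero, add_zero] at this
  rw [this, sub_eq_zero, eq_comm]

/-- The point is that `U` does not vanish in the weighted space: otherwise its fourth derivative
vanishes, `U` is affine, and then `U = 0`. -/
theorem isUnboundedEigenvalue_of_mem {z : ℂ}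
    (hz : z ∈ pencilSpectrum affineProj doubleVolterra Ψ.mulUnit) :
    IsUnboundedEigenvalue Ψ.operator z := by
  obtain ⟨U, hU0, hU⟩ := Ψ.mem_pencilSpectrum_iff.mp hz
  obtain ⟨u, hu1, hu2⟩ := Ψ.rel_iff_exists.mp (Ψ.rel_iff.mpr ⟨U, rfl, hU⟩)
  refine ⟨u, fun h => hU0 ?_, by rw [hu2, hu1]⟩
  rw [hu1] at h
  have h2 := hU.2
  rw [h, smul_zero, map_zero, map_zero, map_zero, sub_eq_zero] at h2
  exact Ψ.eq_zero_of_mem_affineSubspace (affineProj_eq_self_iff.mp h2.symm) h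

/-- The resolvent is multiplication by `Ψ`, then `P + K†K`, then `(1 - A(z))⁻¹`, then the map into
the weighted space. -/
theorem mem_resolventSet_of_notMem {z : ℂ}
    (hz : z ∉ pencilSpectrum affineProj doubleVolterra Ψ.mulUnit) :
    z ∈ unboundedResolventSet Ψ.operator := by
  obtain ⟨R, hR1, hR2⟩ := Ψ.isPencil.exists_inverse hz
  let S : UnitL2 →L[ℂ] UnitL2 := affineProj + adjoint doubleVolterra ∘L doubleVolterra
  have hS : ∀ F, S F = affineProj F + adjoint doubleVolterra (doubleVolterra F) := fun _ => rfl
  refine ⟨Ψ.embed ∘L R ∘L S ∘L Ψ.mulToUnit, fun f => ?_, fun u => ?_⟩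
  · have h1 := Ψ.lift_iff_pencil.mpr (hR1 (S (Ψ.mulToUnit f)))
    obtain ⟨u, hu1, hu2⟩ := Ψ.rel_iff_exists.mp (Ψ.rel_iff.mpr ⟨_, rfl, h1⟩)
    have hmem : Ψ.embed (R (S (Ψ.mulToUnit f))) ∈ Ψ.operator.domain := hu1 ▸ u.2
    refine ⟨hmem, ?_⟩
    have : u = ⟨_, hmem⟩ := Subtype.ext hu1
    rw [this] at hu2
    simp only [ContinuousLinearMap.comp_apply]
    rw [hu2, add_sub_cancel_left]
  · obtain ⟨U, hU1, hU2⟩ := Ψ.rel_iff.mp (Ψ.rel_apply u)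
    have h1 : Ψ.Lift U (z • Ψ.embed U + (Ψ.operator u - z • (u : Ψ.Space))) := by
      rwa [hU1, add_sub_cancel]
    rw [Ψ.lift_iff_pencil, ← hS] at h1
    simp only [ContinuousLinearMap.comp_apply]
    rw [← h1, hR2, hU1]

theorem unboundedSpectrum_eq : unboundedSpectrum Ψ.operator =
    pencilSpectrum affineProj doubleVolterra Ψ.mulUnit := by
  refine Subset.antisymm (fun z hz => ?_) fun z hz =>
    (Ψ.isUnboundedEigenvalue_of_mem hz).mem_unboundedSpectrum
  by_contra h
  exact hz (Ψ.mem_resolventSet_of_notMem h)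

theorem im_eq_zero {z : ℂ} (hz : z ∈ unboundedSpectrum Ψ.operator) : z.im = 0 :=
  Ψ.isPencil.im_eq_zero (fun _ => eq_zero_of_doubleVolterra) (fun _ => Ψ.eq_zero_of_mulUnit)
    (Ψ.unboundedSpectrum_eq ▸ hz)

theorem finite_inter_closedBall (r : ℝ) :
    {z ∈ unboundedSpectrum Ψ.operator | ‖z‖ ≤ r}.Finite := by
  rw [Ψ.unboundedSpectrum_eq]
  exact Ψ.isPencil.finite_inter_closedBall (fun _ => eq_zero_of_doubleVolterra)
    (fun _ => Ψ.eq_zero_of_mulUnit) r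

variable {Ψ}

/-- Green's formula: `KΨg` is `U''`, and the affine part of `U₂` drops out because `Ψg₁` is
orthogonal to it. -/
theorem Lift.inner_eq {U₁ U₂ : UnitL2} {g₁ g₂ : Ψ.Space} (h₁ : Ψ.Lift U₁ g₁) (h₂ : Ψ.Lift U₂ g₂) :
    inner ℂ (Ψ.mulToUnit g₁) U₂ =
      inner ℂ (doubleVolterra (Ψ.mulToUnit g₁)) (doubleVolterra (Ψ.mulToUnit g₂)) := by
  have h : U₂ = affineProj U₂ + adjoint doubleVolterra (doubleVolterra (Ψ.mulToUnit g₂)) := by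
    rw [← h₂.2]; abel
  rw [h, inner_add_right, ← inner_apply_of_isSelfAdjoint isSelfAdjoint_affineProj, h₁.1,
    inner_zero_left, zero_add, adjoint_inner_right]

theorem Lift.inner_symm {U₁ U₂ : UnitL2} {g₁ g₂ : Ψ.Space} (h₁ : Ψ.Lift U₁ g₁)
    (h₂ : Ψ.Lift U₂ g₂) : inner ℂ (Ψ.mulToUnit g₁) U₂ = inner ℂ U₁ (Ψ.mulToUnit g₂) := by
  rw [h₁.inner_eq h₂, ← inner_conj_symm U₁, h₂.inner_eq h₁, inner_conj_symm]

theorem Lift.eq_zero {U : UnitL2} {g : Ψ.Space} (h : Ψ.Lift U g)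
    (h0 : inner ℂ (Ψ.mulToUnit g) U = 0) : g = 0 := by
  rw [h.inner_eq h, inner_self_eq_zero] at h0
  exact Ψ.mulToUnit_eq_zero (eq_zero_of_doubleVolterra h.1 h0)

theorem inner_mulToUnit_embed (U W : UnitL2) :
    inner ℂ (Ψ.mulToUnit (Ψ.embed U)) W = inner ℂ U (Ψ.mulToUnit (Ψ.embed W)) :=
  inner_apply_of_isSelfAdjoint Ψ.isSelfAdjoint_mulUnit U W

/-- There are no Jordan chains at nonzero real points. -/
theorem eq_zero_of_jordan_chain {u v : Ψ.Space} {z : ℂ} (hz : z ≠ 0) (him : z.im = 0)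
    (hu : Ψ.Rel u (v + z • u)) (hv : Ψ.Rel v (z • v)) : v = 0 := by
  obtain ⟨U, rfl, hU⟩ := Ψ.rel_iff.mp hu
  obtain ⟨W, rfl, hW⟩ := Ψ.rel_iff.mp hv
  -- Symmetry cancels the terms with `z`, which is real, and leaves `⟨ΨW, W⟩ = 0`; definiteness of
  -- the energy then gives `zW = 0`.
  have h1 := hU.inner_symm hW
  rw [map_add, map_smul, map_smul, inner_add_left, inner_smul_left, inner_smul_right,
    inner_mulToUnit_embed U W, Complex.conj_eq_iff_im.mpr him, add_eq_right] at h1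
  have h2 := hW.eq_zero (by rw [map_smul, inner_smul_left, h1, mul_zero])
  exact (smul_eq_zero.mp h2).resolve_left hz

/-- The Jordan chains at zero have length at most two. -/
theorem eq_zero_of_jordan_chain_zero {u w v : Ψ.Space} (hu : Ψ.Rel u w) (hw : Ψ.Rel w v)
    (hv : Ψ.Rel v 0) : v = 0 := by
  obtain ⟨U, rfl, hU⟩ := Ψ.rel_iff.mp hu
  obtain ⟨W, rfl, hW⟩ := Ψ.rel_iff.mp hw
  obtain ⟨Y, rfl, hY⟩ := Ψ.rel_iff.mp hv
  -- The energy of `W` is `⟨ΨY, W⟩ = ⟨Y, ΨW⟩ = ⟨Y, U⁗⟩ = ⟨Y⁗, U⟩ = 0`.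
  refine hW.eq_zero ?_
  rw [inner_mulToUnit_embed, ← hY.inner_symm hU, map_zero, inner_zero_left]

variable (Ψ)

theorem mem_iteratedKer_operator_succ {z : ℂ} {n : ℕ} {v : Ψ.Space} :
    v ∈ iteratedKer Ψ.operator z (n + 1) ↔
      ∃ w ∈ iteratedKer Ψ.operator z n, Ψ.Rel v (w + z • v) := by
  rw [mem_iteratedKer_succ]
  constructor
  · rintro ⟨u, rfl, hu⟩
    exact ⟨_, hu, by rw [sub_add_cancel]; exact Ψ.rel_apply u⟩
  · rintro ⟨w, hw, hvw⟩
    obtain ⟨u, rfl, hu⟩ := Ψ.rel_iff_exists.mp hvw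
    exact ⟨u, rfl, by rwa [hu, add_sub_cancel_right]⟩

theorem mem_iteratedKer_operator_one {z : ℂ} {v : Ψ.Space} :
    v ∈ iteratedKer Ψ.operator z 1 ↔ Ψ.Rel v (z • v) := by
  rw [mem_iteratedKer_operator_succ]
  constructor
  · rintro ⟨w, hw, h⟩
    have hw0 : w = 0 := hw
    rwa [hw0, zero_add] at h
  · exact fun h => ⟨0, Submodule.zero_mem _, by rwa [zero_add]⟩

/-- The second level serves all real `z` at once: chains of length two are excluded for `z ≠ 0`, but
only those of length three at `z = 0`. -/
theorem iteratedKer_three_le {z : ℂ} (him : z.im = 0) :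
    iteratedKer Ψ.operator z 3 ≤ iteratedKer Ψ.operator z 2 := by
  intro u hu
  obtain ⟨w, hw, huw⟩ := Ψ.mem_iteratedKer_operator_succ.mp hu
  obtain ⟨v, hv, hwv⟩ := Ψ.mem_iteratedKer_operator_succ.mp hw
  have hv1 := Ψ.mem_iteratedKer_operator_one.mp hv
  have hv0 : v = 0 := by
    rcases eq_or_ne z 0 with rfl | hz
    · simp only [zero_smul, add_zero] at huw hwv hv1
      exact eq_zero_of_jordan_chain_zero huw hwv hv1
    · exact eq_zero_of_jordan_chain hz him hwv hv1
  rw [hv0, zero_add] at hwv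
  exact Ψ.mem_iteratedKer_operator_succ.mpr ⟨w, Ψ.mem_iteratedKer_operator_one.mpr hwv, huw⟩

theorem finiteDimensional_rootSubspace {z : ℂ} (him : z.im = 0) :
    FiniteDimensional ℂ (rootSubspace Ψ.operator z) := by
  have h1 : FiniteDimensional ℂ (iteratedKer Ψ.operator z 1) := by
    have := Ψ.isPencil.finiteDimensional_fixed z
    refine Submodule.finiteDimensional_of_le (S₂ := (eigenspace
      (pencil affineProj doubleVolterra Ψ.mulUnit z).toLinearMap 1).map Ψ.embed.toLinearMap) ?_
    intro v hv
    obtain ⟨U, rfl, hU⟩ := Ψ.rel_iff.mp (Ψ.mem_iteratedKer_operator_one.mp hv)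
    refine ⟨U, ?_, rfl⟩
    have := Ψ.lift_iff_pencil (U := U) (g := 0) (z := z)
    simp only [map_zero, add_zero] at this
    rw [this, sub_eq_zero] at hU
    rw [SetLike.mem_coe, mem_eigenspace_iff, one_smul]
    exact hU.symm
  have h2 := finiteDimensional_iteratedKer h1 2
  exact Submodule.finiteDimensional_of_le (rootSubspace_le_of_succ_le (Ψ.iteratedKer_three_le him))

theorem hasDiscreteSpectrum : HasDiscreteSpectrum Ψ.operator where
  not_accPt z hz := by
    rw [accPt_principal_iff_nhdsWithin] at hz
    have h1 := Ψ.finite_inter_closedBall (‖z‖ + 1)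
    have h2 : {w ∈ unboundedSpectrum Ψ.operator | ‖w‖ ≤ ‖z‖ + 1} \ {z} ∈
        𝓝[unboundedSpectrum Ψ.operator \ {z}] z := by
      rw [mem_nhdsWithin]
      refine ⟨Metric.ball z 1, Metric.isOpen_ball, Metric.mem_ball_self one_pos, ?_⟩
      rintro w ⟨hw, hws, hwz⟩
      refine ⟨⟨hws, ?_⟩, hwz⟩
      rw [Metric.mem_ball, dist_eq_norm] at hw
      have := norm_le_norm_add_norm_sub' w z
      linarith
    have h3 : ({w ∈ unboundedSpectrum Ψ.operator | ‖w‖ ≤ ‖z‖ + 1} \ {z})ᶜ ∈ 𝓝 z :=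
      (h1.subset sdiff_subset).isClosed.isOpen_compl.mem_nhds fun h => h.2 rfl
    have h4 := inter_mem h2 (mem_nhdsWithin_of_mem_nhds h3)
    rw [inter_compl_self, empty_mem_iff_bot] at h4
    exact hz.ne h4
  eigenvalue z hz := Ψ.isUnboundedEigenvalue_of_mem (Ψ.unboundedSpectrum_eq ▸ hz)
  finite_mult z hz := Ψ.finiteDimensional_rootSubspace (Ψ.im_eq_zero hz)

end Shape

/-! ### Resonances -/

namespace Shape

variable {Ψ : Shape}

theorem IsResonance.mem_resonantSet {α : ℝ} {w : ℝ → ℂ} (h : Ψ.IsResonance α w) :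
    α ∈ Ψ.resonantSet := by
  have hd : ∀ n < 4, ∀ x ∈ Icc (-1 : ℝ) 1, HasDerivWithinAt (iteratedDerivWithin n w (Icc (-1) 1))
      (iteratedDerivWithin (n + 1) w (Icc (-1) 1) x) (Icc (-1) 1) x := by
    intro n hn x hx
    rw [iteratedDerivWithin_succ]
    exact (h.contDiffOn.differentiableOn_iteratedDerivWithin (by exact_mod_cast hn)
      uniqueDiffOn_Icc_neg_one_one x hx).hasDerivWithinAt
  have hc : ContinuousOn (iteratedDerivWithin 4 w (Icc (-1) 1)) (Icc (-1) 1) :=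
    h.contDiffOn.continuousOn_iteratedDerivWithin (by norm_num) uniqueDiffOn_Icc_neg_one_one
  have hw : IsW42 w (iteratedDerivWithin 4 w (Icc (-1) 1)) :=
    { contDiffOn := h.contDiffOn.of_le (by norm_num)
      memLp := memLp_of_continuousOn hc
      eq_integral := fun x hx => eq_add_prim hc (hd 3 (by norm_num)) hx }
  have hwc : ContinuousOn w (Icc (-1) 1) := h.contDiffOn.continuousOn
  let f : Ψ.Space := MemLp.toLp w (Ψ.memLp_weight (memLp_of_continuousOn hwc))
  have hf : f =ᵐ[Ψ.weight] w := MemLp.coeFn_toLp _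
  have hrel : Ψ.Rel f (((-α : ℝ) : ℂ) • f) := by
    refine ⟨w, _, hw, h.boundary, hf, ?_⟩
    have h1 : (((-α : ℝ) : ℂ) • f : Ψ.Space) =ᵐ[Ψ.weight] fun x => ((-α : ℝ) : ℂ) * w x := by
      filter_upwards [Lp.coeFn_smul ((-α : ℝ) : ℂ) f, hf] with x h1 h2
      rw [h1, Pi.smul_apply, h2, smul_eq_mul]
    filter_upwards [Ψ.ae_mul_congr h1, ae_restrict_mem measurableSet_Ioo] with x h2 h3
    rw [h2, eq_neg_of_add_eq_zero_left (h.equation x h3)]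
    push_cast
    ring
  obtain ⟨u, hu, hTu⟩ := Ψ.rel_iff_exists.mp hrel
  refine IsUnboundedEigenvalue.mem_unboundedSpectrum ⟨u, fun h0 => ?_, by rw [hTu, hu]⟩
  obtain ⟨x, hx, hwx⟩ := h.nontrivial
  refine hwx (Ψ.eqOn_zero_of_ae_weight hwc ?_ (Ioo_subset_Icc_self hx))
  rw [hu, Lp.eq_zero_iff_ae_eq_zero] at h0
  filter_upwards [h0, hf] with x h1 h2
  rw [← h2, h1, Pi.zero_apply]

/-- Regularity: the fourth derivative agrees almost everywhere with the continuous function `-αΨu`,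
so the third derivative is a primitive of it and `u` is `C⁴`. -/
theorem exists_isResonance {α : ℝ} (hα : α ∈ Ψ.resonantSet) : ∃ w, Ψ.IsResonance α w := by
  obtain ⟨f, hf0, hf⟩ := Ψ.hasDiscreteSpectrum.eigenvalue _ hα
  obtain ⟨u, v, hw, hb, hfu, hv⟩ := Ψ.rel_apply f
  rw [hf] at hv
  have huc : ContinuousOn u (Icc (-1) 1) := hw.contDiffOn.continuousOn
  let k : ℝ → ℂ := fun x => (Ψ x : ℂ) * (((-α : ℝ) : ℂ) * u x)
  have hk : ContinuousOn k (Icc (-1) 1) :=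
    (Complex.continuous_ofReal.comp Ψ.smooth.continuous).continuousOn.mul
      (continuousOn_const.mul huc)
  have hvk : v =ᵐ[unitMeasure] k := by
    refine EventuallyEq.trans hv (Ψ.ae_mul_congr ?_)
    filter_upwards [Lp.coeFn_smul ((-α : ℝ) : ℂ) (f : Ψ.Space), hfu] with x h1 h2
    rw [h1, Pi.smul_apply, h2, smul_eq_mul]
  have h3 : EqOn (iteratedDerivWithin 3 u (Icc (-1) 1))
      (fun x => iteratedDerivWithin 3 u (Icc (-1) 1) (-1) + prim k x) (Icc (-1) 1) := by
    intro x hx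
    rw [hw.eq_integral x hx]
    exact congrArg _ (prim_congr hvk hx)
  have hd3 : ∀ x ∈ Icc (-1 : ℝ) 1,
      HasDerivWithinAt (iteratedDerivWithin 3 u (Icc (-1) 1)) (k x) (Icc (-1) 1) x :=
    fun x hx => ((hasDerivWithinAt_prim hk hx).const_add _).congr_of_mem h3 hx
  have hC : ContDiffOn ℝ 4 u (Icc (-1) 1) := by
    have h0 : ContDiffOn ℝ (0 : ℕ) k (Icc (-1) 1) := contDiffOn_zero.mpr hk
    have h1 := contDiffOn_succ_of_hasDerivWithinAt hd3 h0
    have h2 := contDiffOn_succ_of_hasDerivWithinAt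
      (fun y hy => hw.hasDerivWithinAt (n := 2) (by norm_num) hy) h1
    have h3 := contDiffOn_succ_of_hasDerivWithinAt
      (fun y hy => hw.hasDerivWithinAt (n := 1) (by norm_num) hy) h2
    have h4 := contDiffOn_succ_of_hasDerivWithinAt
      (fun y hy => hw.hasDerivWithinAt (n := 0) (by norm_num) hy) h3
    rwa [iteratedDerivWithin_zero] at h4
  refine ⟨u, hC, fun x hx => ?_, hb, ?_⟩
  · have hx' := Ioo_subset_Icc_self hx
    rw [iteratedDerivWithin_succ,
      (hd3 x hx').derivWithin (uniqueDiffOn_Icc_neg_one_one x hx')]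
    simp only [k]
    push_cast
    ring
  · by_contra! h0
    refine hf0 ((Lp.eq_zero_iff_ae_eq_zero).mpr ?_)
    have hI : ∀ᵐ x ∂Ψ.weight, x ∈ Ioo (-1 : ℝ) 1 :=
      Ψ.ae_weight_of_ae_unit (ae_restrict_mem measurableSet_Ioo)
    filter_upwards [hfu, hI] with x h1 h2
    rw [h1, h0 x h2, Pi.zero_apply]

theorem resonantSet_eq (Ψ : Shape) : Ψ.resonantSet = {α : ℝ | ∃ w : ℝ → ℂ, Ψ.IsResonance α w} :=
  Subset.antisymm (fun _ h => exists_isResonance h) fun _ ⟨_, h⟩ => h.mem_resonantSet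

theorem unboundedSpectrum_eq_image (Ψ : Shape) : unboundedSpectrum Ψ.operator =
    (fun α : ℝ => ((-α : ℝ) : ℂ)) '' Ψ.resonantSet := by
  ext z
  constructor
  · intro hz
    have him := Ψ.im_eq_zero hz
    have h1 : ((-(-z.re) : ℝ) : ℂ) = z := by
      rw [neg_neg]; exact Complex.ext rfl him.symm
    exact ⟨-z.re, show ((-(-z.re) : ℝ) : ℂ) ∈ _ by rwa [h1], h1⟩
  · rintro ⟨α, hα, rfl⟩
    exact hα

end Shape

/-! ### Positive eigenvalues -/

section Bump

open Polynomial

variable {x₀ : ℝ} (φ : ContDiffBump x₀)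

/-- The product of a bump function and a polynomial. -/
noncomputable def bumpMul (p : ℂ[X]) (x : ℝ) : ℂ := (φ x : ℂ) * p.eval (x : ℂ)

theorem contDiff_bumpMul (p : ℂ[X]) : ContDiff ℝ ∞ (bumpMul φ p) := by
  have h1 : ContDiff ℝ ∞ fun x : ℝ => (φ x : ℂ) := Complex.ofRealCLM.contDiff.comp φ.contDiff
  have h3 : ContDiff ℂ ∞ fun x : ℂ => p.eval x := by
    simpa using p.contDiff_aeval (𝕜 := ℂ) (R := ℂ) ∞
  have h2 : ContDiff ℝ ∞ fun x : ℝ => p.eval (x : ℂ) :=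
    (h3.restrict_scalars ℝ).comp Complex.ofRealCLM.contDiff
  exact h1.mul h2

theorem hasDerivAt_bumpMul (p : ℂ[X]) (x : ℝ) :
    HasDerivAt (bumpMul φ p) (deriv (bumpMul φ p) x) x :=
  ((contDiff_bumpMul φ p).differentiable (by simp) x).hasDerivAt

theorem contDiff_deriv_bumpMul (p : ℂ[X]) : ContDiff ℝ ∞ (deriv (bumpMul φ p)) :=
  (contDiff_infty_iff_deriv.mp (contDiff_bumpMul φ p)).2

theorem hasDerivAt_deriv_bumpMul (p : ℂ[X]) (x : ℝ) :
    HasDerivAt (deriv (bumpMul φ p)) (deriv (deriv (bumpMul φ p)) x) x :=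
  ((contDiff_deriv_bumpMul φ p).differentiable (by simp) x).hasDerivAt

theorem continuous_deriv_deriv_bumpMul (p : ℂ[X]) :
    Continuous (deriv (deriv (bumpMul φ p))) :=
  (contDiff_infty_iff_deriv.mp (contDiff_deriv_bumpMul φ p)).2.continuous

theorem bumpMul_add (p q : ℂ[X]) : bumpMul φ (p + q) = bumpMul φ p + bumpMul φ q := by
  ext x; simp [bumpMul, mul_add]

theorem bumpMul_smul (c : ℂ) (p : ℂ[X]) : bumpMul φ (c • p) = c • bumpMul φ p := by
  ext x; simp [bumpMul]; ring

theorem deriv_deriv_bumpMul_add (p q : ℂ[X]) : deriv (deriv (bumpMul φ (p + q))) =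
    deriv (deriv (bumpMul φ p)) + deriv (deriv (bumpMul φ q)) := by
  have h : deriv (bumpMul φ (p + q)) = deriv (bumpMul φ p) + deriv (bumpMul φ q) := by
    ext x
    rw [bumpMul_add]
    exact ((hasDerivAt_bumpMul φ p x).add (hasDerivAt_bumpMul φ q x)).deriv
  ext x
  rw [h]
  exact ((hasDerivAt_deriv_bumpMul φ p x).add (hasDerivAt_deriv_bumpMul φ q x)).deriv

theorem deriv_deriv_bumpMul_smul (c : ℂ) (p : ℂ[X]) : deriv (deriv (bumpMul φ (c • p))) =
    c • deriv (deriv (bumpMul φ p)) := by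
  have h : deriv (bumpMul φ (c • p)) = c • deriv (bumpMul φ p) := by
    ext x
    rw [bumpMul_smul]
    exact ((hasDerivAt_bumpMul φ p x).const_smul c).deriv
  ext x
  rw [h]
  exact ((hasDerivAt_deriv_bumpMul φ p x).const_smul c).deriv

theorem memLp_bumpMul (p : ℂ[X]) : MemLp (bumpMul φ p) 2 unitMeasure :=
  memLp_of_continuousOn (contDiff_bumpMul φ p).continuous.continuousOn

theorem memLp_deriv_deriv_bumpMul (p : ℂ[X]) :
    MemLp (deriv (deriv (bumpMul φ p))) 2 unitMeasure :=
  memLp_of_continuousOn (continuous_deriv_deriv_bumpMul φ p).continuousOn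

/-- The products of a bump function and polynomials, in `L²(-1, 1)`. -/
noncomputable def bumpMulL2 : ℂ[X] →ₗ[ℂ] UnitL2 where
  toFun p := MemLp.toLp _ (memLp_bumpMul φ p)
  map_add' p q := by
    rw [← MemLp.toLp_add, MemLp.toLp_eq_toLp_iff, bumpMul_add]
  map_smul' c p := by
    rw [RingHom.id_apply, ← MemLp.toLp_const_smul, MemLp.toLp_eq_toLp_iff, bumpMul_smul]

/-- The second derivatives of the products of a bump function and polynomials. -/
noncomputable def derivDerivBumpMulL2 : ℂ[X] →ₗ[ℂ] UnitL2 where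
  toFun p := MemLp.toLp _ (memLp_deriv_deriv_bumpMul φ p)
  map_add' p q := by
    rw [← MemLp.toLp_add, MemLp.toLp_eq_toLp_iff, deriv_deriv_bumpMul_add]
  map_smul' c p := by
    rw [RingHom.id_apply, ← MemLp.toLp_const_smul, MemLp.toLp_eq_toLp_iff,
      deriv_deriv_bumpMul_smul]

theorem coeFn_bumpMulL2 (p : ℂ[X]) : bumpMulL2 φ p =ᵐ[unitMeasure] bumpMul φ p :=
  MemLp.coeFn_toLp (memLp_bumpMul φ p)

theorem coeFn_derivDerivBumpMulL2 (p : ℂ[X]) :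
    derivDerivBumpMulL2 φ p =ᵐ[unitMeasure] deriv (deriv (bumpMul φ p)) :=
  MemLp.coeFn_toLp (memLp_deriv_deriv_bumpMul φ p)

/-- The function vanishes near `-1`, so both constants of integration are zero. -/
theorem volterra_volterra_derivDerivBumpMulL2 (hφ : Metric.closedBall x₀ φ.rOut ⊆ Ioo (-1) 1)
    (p : ℂ[X]) : volterra (volterra (derivDerivBumpMulL2 φ p)) = bumpMulL2 φ p := by
  have h0 : bumpMul φ p =ᶠ[𝓝 (-1)] fun _ => 0 := by
    have hmem : (Metric.closedBall x₀ φ.rOut)ᶜ ∈ 𝓝 (-1 : ℝ) :=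
      Metric.isClosed_closedBall.isOpen_compl.mem_nhds fun h => lt_irrefl _ (hφ h).1
    filter_upwards [hmem] with x hx
    have : φ x = 0 := φ.zero_of_le_dist (not_le.mp fun h => hx h).le
    simp [bumpMul, this]
  have h1 : deriv (bumpMul φ p) (-1) = 0 := by
    rw [h0.deriv_eq, deriv_const]
  have e1 : EqOn (deriv (bumpMul φ p)) (prim (deriv (deriv (bumpMul φ p)))) (Icc (-1) 1) := by
    intro x hx
    rw [eq_add_prim (continuous_deriv_deriv_bumpMul φ p).continuousOn
      (fun y _ => (hasDerivAt_deriv_bumpMul φ p y).hasDerivWithinAt) hx, h1, zero_add]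
  refine Lp.ext ?_
  filter_upwards [coeFn_bumpMulL2 φ p, coeFn_volterra_of_ae_eq (coeFn_volterra_of_ae_eq
    (coeFn_derivDerivBumpMulL2 φ p)), ae_restrict_mem measurableSet_Ioo] with x h2 h3 h4
  have hx := Ioo_subset_Icc_self h4
  rw [h2, h3, eq_add_prim (contDiff_deriv_bumpMul φ p).continuous.continuousOn
    (fun y _ => (hasDerivAt_bumpMul φ p y).hasDerivWithinAt) hx, h0.eq_of_nhds, zero_add,
    prim_congr_Icc e1 hx]

theorem re_inner_bumpMulL2_pos {ψ : ℝ → ℝ} (hψ : Continuous ψ) {M : UnitL2 →L[ℂ] UnitL2}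
    (hM : ∀ f, M f =ᵐ[unitMeasure] fun x => (ψ x : ℂ) * f x)
    (hφ : Metric.closedBall x₀ φ.rOut ⊆ Ioo (-1) 1)
    (hpos : ∀ x ∈ Metric.closedBall x₀ φ.rOut, 0 < ψ x) {p : ℂ[X]} (hp : p ≠ 0) :
    0 < (inner ℂ (M (bumpMulL2 φ p)) (bumpMulL2 φ p)).re := by
  have h1 : M (bumpMulL2 φ p) =ᵐ[unitMeasure] fun x => (ψ x : ℂ) * bumpMul φ p x := by
    filter_upwards [hM (bumpMulL2 φ p), coeFn_bumpMulL2 φ p] with x h1 h2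
    rw [h1, h2]
  have h2 : inner ℂ (M (bumpMulL2 φ p)) (bumpMulL2 φ p) =
      ((∫ x in (-1 : ℝ)..1, ψ x * ‖bumpMul φ p x‖ ^ 2 : ℝ) : ℂ) := by
    rw [inner_eq_intervalIntegral _ _ h1 (coeFn_bumpMulL2 φ p), ← intervalIntegral.integral_ofReal]
    refine intervalIntegral.integral_congr fun x _ => ?_
    simp only [map_mul, Complex.conj_ofReal, Complex.ofReal_mul, Complex.ofReal_pow]
    rw [mul_assoc, mul_comm ((starRingEnd ℂ) _), Complex.mul_conj']
  rw [h2, Complex.ofReal_re]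
  have hzero : ∀ x ∉ Metric.closedBall x₀ φ.rOut, bumpMul φ p x = 0 := by
    intro x hx
    have : φ x = 0 := φ.zero_of_le_dist (not_le.mp fun h => hx h).le
    simp [bumpMul, this]
  refine intervalIntegral.integral_pos (by norm_num)
    (hψ.mul ((contDiff_bumpMul φ p).continuous.norm.pow 2)).continuousOn (fun x _ => ?_) ?_
  · by_cases hx : x ∈ Metric.closedBall x₀ φ.rOut
    · exact mul_nonneg (hpos x hx).le (sq_nonneg _)
    · rw [hzero x hx]; simp
  -- The integrand is nonnegative and continuous; it is positive at any point of the open ball that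
  -- is not a root of `p`.
  · have hroots : {x : ℝ | p.eval (x : ℂ) = 0}.Finite := by
      refine ((p.rootSet_finite ℂ).preimage Complex.ofReal_injective.injOn).subset fun x hx => ?_
      rw [mem_preimage, mem_rootSet]
      exact ⟨hp, by simpa using hx⟩
    have hinf : (Metric.ball x₀ φ.rOut).Infinite := by
      rw [Real.ball_eq_Ioo]
      exact Ioo_infinite (by linarith [φ.rOut_pos])
    obtain ⟨c, hc, hc'⟩ := hinf.exists_notMem_finite hroots
    have hcc := Metric.ball_subset_closedBall hc
    refine ⟨c, Ioo_subset_Icc_self (hφ hcc), mul_pos (hpos c hcc) (pow_pos (norm_pos_iff.mpr ?_) 2)⟩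
    exact mul_ne_zero (by exact_mod_cast (φ.pos_of_mem_ball hc).ne') hc'

/-- Test vectors are `a = φp` with `b = (φp)''`, so that `a - Pa = K†b`. A general `ψ` allows use
with both `Ψ` and `-Ψ`. -/
theorem infinite_pos_pencilSpectrum {ψ : ℝ → ℝ} (hψ : Continuous ψ) {M : UnitL2 →L[ℂ] UnitL2}
    (hMs : IsSelfAdjoint M) (hM : ∀ f, M f =ᵐ[unitMeasure] fun x => (ψ x : ℂ) * f x)
    (hpos : ∃ x ∈ Ioo (-1 : ℝ) 1, 0 < ψ x) :
    {t : ℝ | 0 < t ∧ (t : ℂ) ∈ pencilSpectrum affineProj doubleVolterra M}.Infinite := by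
  obtain ⟨x₀, hx₀, hψ₀⟩ := hpos
  have hopen : IsOpen (Ioo (-1 : ℝ) 1 ∩ {x | 0 < ψ x}) :=
    isOpen_Ioo.inter (isOpen_lt continuous_const hψ)
  obtain ⟨ε, hε, hsub⟩ := Metric.nhds_basis_closedBall.mem_iff.mp (hopen.mem_nhds ⟨hx₀, hψ₀⟩)
  let φ : ContDiffBump x₀ := ⟨ε / 2, ε, half_pos hε, half_lt_self hε⟩
  refine (isPencil_unit hMs).infinite_pos Polynomial.not_finite (bumpMulL2 φ)
    (derivDerivBumpMulL2 φ) (fun p => ?_) fun p hp =>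
      re_inner_bumpMulL2_pos φ hψ hM (fun x hx => (hsub hx).1) (fun x hx => (hsub hx).2) hp
  rw [adjoint_doubleVolterra,
    volterra_volterra_derivDerivBumpMulL2 φ (fun x hx => (hsub hx).1)]

end Bump

/-! ### Accumulation of the spectrum at both infinities -/

namespace Shape

variable (Ψ : Shape)

theorem mem_Ioo_of_ne_zero {x : ℝ} (hx : Ψ x ≠ 0) : x ∈ Ioo (-1 : ℝ) 1 := by
  rw [← interior_Icc, ← Ψ.tsupport_eq]
  exact interior_maximal subset_closure Ψ.smooth.continuous.isOpen_support hx

theorem infinite_pos_spectrum (h : ∃ x, 0 < Ψ x) :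
    {t : ℝ | 0 < t ∧ (t : ℂ) ∈ unboundedSpectrum Ψ.operator}.Infinite := by
  obtain ⟨x, hx⟩ := h
  rw [Ψ.unboundedSpectrum_eq]
  exact infinite_pos_pencilSpectrum Ψ.smooth.continuous Ψ.isSelfAdjoint_mulUnit Ψ.coeFn_mulUnit
    ⟨x, Ψ.mem_Ioo_of_ne_zero hx.ne', hx⟩

/-- Changing the sign of `M` in the pencil amounts to changing the sign of `z`. -/
theorem infinite_neg_spectrum (h : ∃ x, Ψ x < 0) :
    {t : ℝ | 0 < t ∧ ((-t : ℝ) : ℂ) ∈ unboundedSpectrum Ψ.operator}.Infinite := by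
  obtain ⟨x, hx⟩ := h
  have h1 := infinite_pos_pencilSpectrum (ψ := fun x => -Ψ x) (M := -Ψ.mulUnit)
    Ψ.smooth.continuous.neg Ψ.isSelfAdjoint_mulUnit.neg (fun f => by
      filter_upwards [Ψ.coeFn_mulUnit f, Lp.coeFn_neg (Ψ.mulUnit f)] with x h1 h2
      rw [_root_.neg_apply, h2, Pi.neg_apply, h1]
      push_cast
      ring) ⟨x, Ψ.mem_Ioo_of_ne_zero hx.ne, neg_pos.mpr hx⟩
  rw [Ψ.unboundedSpectrum_eq]
  refine h1.mono ?_
  rintro t ⟨ht, u, hu0, hu⟩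
  refine ⟨ht, u, hu0, ?_⟩
  rw [pencil_neg] at hu
  rwa [Complex.ofReal_neg]

/-- Bounded parts of the spectrum are finite, so an infinite part is unbounded; `σ = ±1` selects the
half-line. -/
theorem exists_lt_of_infinite {σ : ℝ} (hσ : |σ| = 1)
    (h : {t : ℝ | 0 < t ∧ ((σ * t : ℝ) : ℂ) ∈ unboundedSpectrum Ψ.operator}.Infinite) (r : ℝ) :
    ∃ t, r < t ∧ ((σ * t : ℝ) : ℂ) ∈ unboundedSpectrum Ψ.operator := by
  by_contra! hno
  have hσ0 : σ ≠ 0 := by rintro rfl; simp at hσ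
  refine h (((Ψ.finite_inter_closedBall r).preimage
    (f := fun t : ℝ => ((σ * t : ℝ) : ℂ)) ?_).subset ?_)
  · intro s _ t _ hst
    exact mul_left_cancel₀ hσ0 (Complex.ofReal_injective hst)
  · rintro t ⟨ht, hts⟩
    refine ⟨hts, ?_⟩
    rw [Complex.norm_real, norm_mul, Real.norm_eq_abs, Real.norm_eq_abs, hσ, one_mul,
      abs_of_pos ht]
    by_contra! hlt
    exact hno t hlt hts

theorem extendedAccumulationPoints_eq (h : Ψ.ChangesSign) :
    extendedAccumulationPoints Ψ.operator = {⊥, ⊤} := by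
  ext x
  constructor
  · intro hx
    induction x with
    | bot => exact Or.inl rfl
    | top => exact Or.inr rfl
    | coe x =>
      -- A finite accumulation point in the extended line would, through the embedding of `ℝ`, be
      -- one in `ℂ`.
      refine absurd ?_ (Ψ.hasDiscreteSpectrum.not_accPt (x : ℂ))
      have hx' : AccPt (x : EReal) (𝓟 ((fun t : ℝ => (t : EReal)) ''
        {t : ℝ | (t : ℂ) ∈ unboundedSpectrum Ψ.operator})) := hx
      rw [accPt_iff_frequently, EReal.nhds_coe, frequently_map] at hx'
      rw [accPt_iff_frequently]
      refine (Complex.continuous_ofReal.tendsto x).frequently (hx'.mono ?_)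
      rintro t ⟨ht, s, hs, hst⟩
      rw [EReal.coe_injective hst] at hs
      exact ⟨fun h => ht (by rw [Complex.ofReal_injective h]), hs⟩
  · rintro (rfl | rfl)
    · refine accPt_iff_nhds.mpr fun U hU => ?_
      obtain ⟨y, hy⟩ := EReal.mem_nhds_bot_iff.mp hU
      obtain ⟨t, ht, hts⟩ := Ψ.exists_lt_of_infinite (σ := -1) (by simp)
        (by simpa using Ψ.infinite_neg_spectrum h.2) (-y)
      refine ⟨((-1 * t : ℝ) : EReal), ⟨hy ?_, _, hts, rfl⟩, EReal.coe_ne_bot _⟩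
      exact EReal.coe_lt_coe_iff.mpr (by linarith)
    · refine accPt_iff_nhds.mpr fun U hU => ?_
      obtain ⟨y, hy⟩ := EReal.mem_nhds_top_iff.mp hU
      obtain ⟨t, ht, hts⟩ := Ψ.exists_lt_of_infinite (σ := 1) (by simp)
        (by simpa using Ψ.infinite_pos_spectrum h.1) y
      refine ⟨((1 * t : ℝ) : EReal), ⟨hy ?_, _, hts, rfl⟩, EReal.coe_ne_top _⟩
      exact EReal.coe_lt_coe_iff.mpr (by linarith)

end Shape

theorem theorem2 (Ψ : Shape) :
    -- the spectrum is real
    (∀ z ∈ unboundedSpectrum Ψ.operator, z.im = 0) ∧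
    -- the spectrum is discrete
    HasDiscreteSpectrum Ψ.operator ∧
    -- if `Ψ` changes sign, the spectrum accumulates exactly at `-∞` and `+∞`
    (Ψ.ChangesSign → extendedAccumulationPoints Ψ.operator = {⊥, ⊤}) ∧
    -- the spectrum determines the resonant set, the set of `α` for which the problem
    -- `w⁗ + α Ψ w = 0`, `w''(±1) = w'''(±1) = 0` has a nontrivial solution
    unboundedSpectrum Ψ.operator = (fun α : ℝ => ((-α : ℝ) : ℂ)) '' Ψ.resonantSet ∧
    Ψ.resonantSet = {α : ℝ | ∃ w : ℝ → ℂ, Ψ.IsResonance α w} :=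
  ⟨fun _ => Ψ.im_eq_zero, Ψ.hasDiscreteSpectrum, Ψ.extendedAccumulationPoints_eq,
    Ψ.unboundedSpectrum_eq_image, Ψ.resonantSet_eq⟩
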